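/- Let $\lambda>0$ and $0\le a<b\le\pi$. For $p\in\mathbb R$ and $\gamma\in[0,\pi]$ let $\ell_{(p,\gamma)}=\{(x,y)\in\mathbb R^2: x\cos\gamma+y\sin\gamma=p\}$, and let $B_r\subset\mathbb R^2$ be the closed disc of radius $r>0$ centred at the origin. Define $$f_{B(a,b)}\big((p_1,\gamma_1),(p_2,\gamma_2)\big)=\begin{cases}1&\text{if }\ell_{(p_1,\gamma_1)}\cap\ell_{(p_2,\gamma_2)}\cap B_r\neq\emptyset,\ 0\le\gamma_1\wedge\gamma_2\le a\text{ and }\gamma_1\vee\gamma_2\le b,\\0&\text{otherwise.}\end{cases}$$ For each $r>0$ let $X_1,X_2,\dots$ be independent random vectors, uniformly distributed on $[-r,r]\times[0,\pi]$, and let $N_r$ be independent of them and Poisson distributed with mean $2\lambda r$. Put $$\mu_{B(a,b)}=\mathbb E f_{B(a,b)}(X_1,X_2),\qquad \sigma^{(1,2)}_{B(a,b)}=\mathbb E\big[f_{B(a,b)}(X_1,X_2)\,f_{B(a,b)}(X_2,X_3)\big].$$ These numbers do not depend on $r$, they satisfy $\mu_{B(a,b)}^2\le\sigma^{(1,2)}_{B(a,b)}$,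 and $$\mu_{B(a,b)}=\frac1{2\pi}\big(a-\sin b+\sin(b-a)\big),$$ $$\sigma^{(1,2)}_{B(a,b)}=\frac{2}{3\pi^3}\Big(4a+b+\sin b\cos b-\tfrac72(\sin a+\sin b)+4\sin(b-a)+a\cos b-(b-a)\cos a+\tfrac12\big(\sin(2a-b)-\sin(2b-a)\big)\Big).$$ Moreover, the randomly normalized sum $$Z^{(r)}_{B(a,b)}=\frac{1}{(N_r(N_r-1))^{3/4}}\sum_{1\le i<j\le N_r}\big(f_{B(a,b)}(X_i,X_j)-\mu_{B(a,b)}\big)$$ (with value $0$ if $N_r\le1$) converges in distribution, as $r\to\infty$, to $\mathcal N\big(0,\sigma^{(1,2)}_{B(a,b)}-\mu_{B(a,b)}^2\big)$ (the point mass at $0$ if the variance is $0$). The same convergence holds if $N_r$ and $X_1,\dots,X_{N_r}$ are the number and the parameters $(p,\gamma)$, in any order, of those lines of a stationary isotropic Poisson line process of intensity $\lambda$ that hit $B_r$; here the process is given by the lines $\ell_{(p,\gamma)}$ for the points $(p,\gamma)$ of a Poisson point process on $\mathbb R\times[0,\pi]$ with intensity measure $\lambda\,dp\otimes\frac1\pi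 d\gamma$, realised as a sequence of random points. -/

import Mathlib

open MeasureTheory ProbabilityTheory Filter

/-- The line `{(x, y) : x cos γ + y sin γ = p}` with parameters `(p, γ)`. -/
def planarLine (x : ℝ × ℝ) : Set (EuclideanSpace ℝ (Fin 2)) :=
  {z | z 0 * Real.cos x.2 + z 1 * Real.sin x.2 = x.1}

/-- The parameters `[-r, r] × [0, π]` of the lines that hit the closed disc of radius `r`
about the origin. -/
def lineWindow (r : ℝ) : Set (ℝ × ℝ) :=
  Set.Icc (-r) r ×ˢ Set.Icc 0 Real.pi

open Classical in
/-- The kernel `f_{B(a,b)}`: it is `1` if the two lines have a common point in the closed disc of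
radius `r`, the smaller angle is in `[0, a]` and the larger one is in `[0, b]`; else it is `0`. -/
noncomputable def crossKernel (r a b : ℝ) (x y : ℝ × ℝ) : ℝ :=
  if (planarLine x ∩ planarLine y ∩ Metric.closedBall 0 r).Nonempty ∧
      min x.2 y.2 ∈ Set.Icc 0 a ∧ max x.2 y.2 ∈ Set.Icc 0 b then 1 else 0

/-- The uniform distribution on `[-r, r] × [0, π]`. -/
noncomputable def uniformLine (r : ℝ) : Measure (ℝ × ℝ) :=
  ProbabilityTheory.cond volume (lineWindow r)

/-- `E f(X₁, X₂)` for independent `X₁, X₂` that are uniform on `[-r, r] × [0, π]`. -/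
noncomputable def kernelMean (r a b : ℝ) : ℝ :=
  ∫ z : (ℝ × ℝ) × (ℝ × ℝ), crossKernel r a b z.1 z.2 ∂((uniformLine r).prod (uniformLine r))

/-- `E [f(X₁, X₂) f(X₂, X₃)]` for independent `X₁, X₂, X₃` that are uniform on
`[-r, r] × [0, π]`. -/
noncomputable def kernelSecondMoment (r a b : ℝ) : ℝ :=
  ∫ z : (ℝ × ℝ) × (ℝ × ℝ) × (ℝ × ℝ),
    crossKernel r a b z.1 z.2.1 * crossKernel r a b z.2.1 z.2.2
      ∂((uniformLine r).prod ((uniformLine r).prod (uniformLine r)))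

/-- `μ_{B(a,b)}`, computed in the unit disc. -/
noncomputable def muB (a b : ℝ) : ℝ := kernelMean 1 a b

/-- `σ^{(1,2)}_{B(a,b)}`, computed in the unit disc. -/
noncomputable def sigmaB (a b : ℝ) : ℝ := kernelSecondMoment 1 a b

/-- The randomly normalized sum, for the lines with parameters `x i`, `i ∈ I`; the number of these
lines is `#I`. Its value is `0` if there are fewer than two lines. -/
noncomputable def normalizedSum (r a b : ℝ) (I : Finset ℕ) (x : ℕ → ℝ × ℝ) : ℝ :=
  (∑ p ∈ (I ×ˢ I).filter (fun p => p.1 < p.2), (crossKernel r a b (x p.1) (x p.2) - muB a b)) /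
    ((I.card : ℝ) * ((I.card : ℝ) - 1)) ^ (3 / 4 : ℝ)

/-- `X 0, X 1, …` are independent and uniformly distributed on `[-r, r] × [0, π]`, and `N` is
Poisson distributed with mean `2 λ r` and independent of the sequence `X`. -/
structure IsPoissonLineSample {Ω : Type*} [MeasurableSpace Ω] (P : Measure Ω) (lam r : ℝ)
    (N : Ω → ℕ) (X : ℕ → Ω → ℝ × ℝ) : Prop where
  measurable_N : Measurable N
  measurable_X : ∀ i, Measurable (X i)
  law_N : HasLaw N (poissonMeasure (2 * lam * r).toNNReal) P
  law_X : ∀ i, HasLaw (X i) (uniformLine r) P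
  indep_X : iIndepFun X P
  indep_N_X : IndepFun N (fun ω i => X i ω) P

/-- The intensity measure `λ dp ⊗ dγ / π` on `ℝ × [0, π]` of the parameters of an isotropic
stationary line process of intensity `λ`. -/
noncomputable def lineIntensity (lam : ℝ) : Measure (ℝ × ℝ) :=
  ENNReal.ofReal lam •
    (volume : Measure ℝ).prod (ProbabilityTheory.cond volume (Set.Icc 0 Real.pi))

/-- The counting measure `∑ᵢ δ_{ξ i}`. -/
noncomputable def pointMeasure (ξ : ℕ → ℝ × ℝ) : Measure (ℝ × ℝ) :=
  Measure.sum fun i => Measure.dirac (ξ i)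

/-- The lines with parameters `ξ 0, ξ 1, …` form a stationary and isotropic Poisson line process
of intensity `λ` in the plane: `∑ᵢ δ_{ξ i}` is a Poisson point process with intensity measure
`λ dp ⊗ dγ / π`, that is, the number of points in a measurable set of finite intensity measure is
Poisson distributed with that mean, and the numbers of points in disjoint measurable sets are
independent. -/
structure IsPoissonLineProcess {Ω : Type*} [MeasurableSpace Ω] (P : Measure Ω) (lam : ℝ)
    (ξ : ℕ → Ω → ℝ × ℝ) : Prop where
  measurable : ∀ i, Measurable (ξ i)
  law_count : ∀ B : Set (ℝ × ℝ), MeasurableSet B → lineIntensity lam B ≠ ⊤ →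
    HasLaw (fun ω => pointMeasure (fun i => ξ i ω) B)
      ((poissonMeasure (lineIntensity lam B).toNNReal).map (fun n : ℕ => (n : ENNReal))) P
  indep_count : ∀ (n : ℕ) (B : Fin n → Set (ℝ × ℝ)), (∀ k, MeasurableSet (B k)) →
    Pairwise (fun k l => Disjoint (B k) (B l)) →
    iIndepFun (fun k ω => pointMeasure (fun i => ξ i ω) (B k)) P

open Classical in
/-- The indices of the points in `[-r, r] × [0, π]`, that is, of the lines that hit the closed disc
of radius `r`. For a Poisson line process there are almost surely only finitely many;
in the exceptional case of infinitely many the set is defined to be empty. -/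
noncomputable def windowIndices (r : ℝ) (x : ℕ → ℝ × ℝ) : Finset ℕ :=
  if h : {i : ℕ | x i ∈ lineWindow r}.Finite then h.toFinset else ∅

/-! ### The crossing kernel -/

/-! Dilation carries the uniform lines of one disc to those of another and preserves the kernel, so
everything reduces to `r = 1`. Fix a line with offset `p` and angle `γ`. The lines of angle `γ'`
that cross it inside the unit disc are those whose offset lies in an interval of half-length `√(1 -
p²) |sin (γ' - γ)|`, and this interval stays inside `[-1, 1]`. Hence the conditional mean `h(p, γ)`
of the kernel is `√(1 - p²)` times a trigonometric function of `γ` (`integral_crossKernel_one`). Now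
`μ = E h` and, by symmetry of the kernel, `σ = E h²`. Both are elementary integrals, and `σ - μ²` is
the variance of `h`.

For a fixed number `n` of lines, write `f(x, y) - μ = (h(x) - μ) + (h(y) - μ) + g(x, y)`, where `g`
has mean zero in each variable (Hoeffding decomposition). Summed over pairs, the linear terms give
`(n - 1) ∑ (h(X_i) - μ)`, to which the classical central limit theorem applies because `(n (n -
1))^(3/4)` is of order `n^(3/2)`. The terms in `g` are pairwise orthogonal, so their sum has second
moment of order `n²` and disappears after normalization. Slutsky's theorem combines the two parts
(`tendstoInDistribution_uStatistic`).

The normalization uses the random number of lines itself. Conditionally on `N = n`, the law of the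
sum therefore depends on `n` alone, not on `r`. A Poisson law of growing mean leaves every finite
set, so the mixture over `N` has the same limit as `n → ∞` (`tendsto_integral_sampleSum`).

For the line process, the normalized sum is a measurable functional of the finite counting measure
of the points in the window (`pointFunctional_diracSum`). A comparison of characteristic functionals
shows that this random measure has the law of a Poisson number of independent uniform points
(`IsPoissonLineProcess.map_diracSum_windowIndices`). Weak convergence only sees the laws, so the
second limit theorem follows as the first. -/

theorem isClosed_setOf_lines_meet (r : ℝ) :
    IsClosed {q : (ℝ × ℝ) × (ℝ × ℝ) |
      (planarLine q.1 ∩ planarLine q.2 ∩ Metric.closedBall 0 r).Nonempty} := by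
  have : CompactSpace (Metric.closedBall (0 : EuclideanSpace ℝ (Fin 2)) r) :=
    isCompact_iff_compactSpace.1 (isCompact_closedBall _ _)
  have key : IsClosed {z : Metric.closedBall (0 : EuclideanSpace ℝ (Fin 2)) r ×
      ((ℝ × ℝ) × (ℝ × ℝ)) | z.1.1 ∈ planarLine z.2.1 ∧ z.1.1 ∈ planarLine z.2.2} := by
    simp only [planarLine, Set.mem_ofPred_eq]
    refine IsClosed.inter (isClosed_eq ?_ ?_) (isClosed_eq ?_ ?_) <;> fun_prop
  -- The set is the projection of a closed incidence relation along the compact disc, and such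
  -- projections are closed maps.
  convert isClosedMap_snd_of_compactSpace _ key using 1
  ext q
  constructor
  · rintro ⟨z, ⟨h1, h2⟩, h3⟩
    exact ⟨(⟨z, h3⟩, q), ⟨h1, h2⟩, rfl⟩
  · rintro ⟨⟨z, q'⟩, ⟨h1, h2⟩, rfl⟩
    exact ⟨z.1, ⟨h1, h2⟩, z.2⟩

theorem measurable_crossKernel (r a b : ℝ) :
    Measurable (fun q : (ℝ × ℝ) × (ℝ × ℝ) => crossKernel r a b q.1 q.2) := by
  classical
  unfold crossKernel
  refine Measurable.ite ?_ measurable_const measurable_const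
  refine (isClosed_setOf_lines_meet r).measurableSet.inter (MeasurableSet.inter ?_ ?_)
  · exact measurableSet_Icc.preimage (f := fun q : (ℝ × ℝ) × (ℝ × ℝ) => min q.1.2 q.2.2)
      (by fun_prop)
  · exact measurableSet_Icc.preimage (f := fun q : (ℝ × ℝ) × (ℝ × ℝ) => max q.1.2 q.2.2)
      (by fun_prop)

theorem measurable_crossKernel_right (r a b : ℝ) (x : ℝ × ℝ) : Measurable (crossKernel r a b x) := by
  have h := (measurable_crossKernel r a b).comp (measurable_prodMk_left (x := x))
  exact h

theorem crossKernel_comm (r a b : ℝ) (x y : ℝ × ℝ) :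
    crossKernel r a b x y = crossKernel r a b y x := by
  unfold crossKernel
  rw [Set.inter_comm (planarLine x), min_comm, max_comm]

theorem crossKernel_mem_Icc (r a b : ℝ) (x y : ℝ × ℝ) :
    crossKernel r a b x y ∈ Set.Icc (0 : ℝ) 1 := by
  unfold crossKernel
  split_ifs <;> simp

/-- Dilation by `r` of the line parameters. -/
def dilateLine (r : ℝ) (x : ℝ × ℝ) : ℝ × ℝ := (r * x.1, x.2)

theorem measurable_dilateLine (r : ℝ) : Measurable (dilateLine r) := by
  unfold dilateLine; fun_prop

theorem smul_mem_planarLine_dilateLine {r : ℝ} (hr : 0 < r) (x : ℝ × ℝ)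
    (z : EuclideanSpace ℝ (Fin 2)) : r • z ∈ planarLine (dilateLine r x) ↔ z ∈ planarLine x := by
  simp only [planarLine, dilateLine, Set.mem_ofPred_eq, PiLp.smul_apply, smul_eq_mul]
  rw [mul_assoc, mul_assoc, ← mul_add, mul_right_inj' hr.ne']

/-- The homothety `z ↦ r • z` of the plane multiplies offsets by `r`, keeps angles, and maps the
unit disc onto the disc of radius `r`. -/
theorem crossKernel_dilateLine {r : ℝ} (hr : 0 < r) (a b : ℝ) (x y : ℝ × ℝ) :
    crossKernel r a b (dilateLine r x) (dilateLine r y) = crossKernel 1 a b x y := by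
  have h : (planarLine (dilateLine r x) ∩ planarLine (dilateLine r y) ∩
      Metric.closedBall 0 r).Nonempty ↔
      (planarLine x ∩ planarLine y ∩ Metric.closedBall 0 1).Nonempty := by
    constructor
    · rintro ⟨z, ⟨h1, h2⟩, h3⟩
      have hz : r • (r⁻¹ • z) = z := smul_inv_smul₀ hr.ne' z
      rw [← hz, smul_mem_planarLine_dilateLine hr] at h1 h2
      refine ⟨r⁻¹ • z, ⟨h1, h2⟩, ?_⟩
      rw [mem_closedBall_zero_iff] at h3 ⊢
      rw [norm_smul, norm_inv, Real.norm_of_nonneg hr.le, inv_mul_le_iff₀ hr]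
      simpa using h3
    · rintro ⟨z, ⟨h1, h2⟩, h3⟩
      refine ⟨r • z, ⟨(smul_mem_planarLine_dilateLine hr _ _).2 h1,
        (smul_mem_planarLine_dilateLine hr _ _).2 h2⟩, ?_⟩
      rw [mem_closedBall_zero_iff] at h3 ⊢
      rw [norm_smul, Real.norm_of_nonneg hr.le]
      nlinarith
  classical
  unfold crossKernel
  exact if_congr (and_congr h Iff.rfl) rfl rfl

/-! ### The uniform distribution on the parameters of the lines hitting a disc -/

theorem cond_prod_eq_prod {α β : Type*} [MeasurableSpace α] [MeasurableSpace β] (μ : Measure α)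
    (ν : Measure β) [SigmaFinite μ] [SigmaFinite ν] {s : Set α} {t : Set β} (hs : μ s ≠ ⊤)
    (hs0 : μ s ≠ 0) :
    ProbabilityTheory.cond (μ.prod ν) (s ×ˢ t) =
      (ProbabilityTheory.cond μ s).prod (ProbabilityTheory.cond ν t) := by
  unfold ProbabilityTheory.cond
  rw [Measure.prod_prod, ← Measure.prod_restrict, Measure.prod_smul_left, Measure.prod_smul_right,
    smul_smul, ENNReal.mul_inv (Or.inl hs0) (Or.inl hs)]

theorem uniformLine_eq_prod {r : ℝ} (hr : 0 < r) :
    uniformLine r = (ProbabilityTheory.cond volume (Set.Icc (-r) r)).prod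
      (ProbabilityTheory.cond volume (Set.Icc 0 Real.pi)) := by
  unfold uniformLine lineWindow
  rw [Measure.volume_eq_prod, cond_prod_eq_prod]
  · simp
  · simpa using hr

instance isProbabilityMeasure_cond_Icc_pi :
    IsProbabilityMeasure (ProbabilityTheory.cond (volume : Measure ℝ) (Set.Icc 0 Real.pi)) :=
  cond_isProbabilityMeasure_of_finite (by simp [Real.pi_pos]) (by simp)

theorem isProbabilityMeasure_cond_Icc_symm {r : ℝ} (hr : 0 < r) :
    IsProbabilityMeasure (ProbabilityTheory.cond (volume : Measure ℝ) (Set.Icc (-r) r)) :=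
  cond_isProbabilityMeasure_of_finite (by simpa using hr) (by simp)

theorem isProbabilityMeasure_uniformLine {r : ℝ} (hr : 0 < r) :
    IsProbabilityMeasure (uniformLine r) := by
  have := isProbabilityMeasure_cond_Icc_symm hr
  rw [uniformLine_eq_prod hr]
  infer_instance

theorem map_mul_cond_Icc_symm {r : ℝ} (hr : 0 < r) :
    (ProbabilityTheory.cond (volume : Measure ℝ) (Set.Icc (-1) 1)).map (r * ·) =
      ProbabilityTheory.cond volume (Set.Icc (-r) r) := by
  have hpre : (r * ·) ⁻¹' (Set.Icc (-r) r) = Set.Icc (-1 : ℝ) 1 := by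
    rw [Set.preimage_const_mul_Icc₀ _ _ hr]
    simp [hr.ne']
  have hrestrict : (volume.restrict (Set.Icc (-1 : ℝ) 1)).map (r * ·) =
      (volume.map (r * ·)).restrict (Set.Icc (-r) r) := by
    rw [Measure.restrict_map (by fun_prop) measurableSet_Icc, hpre]
  unfold ProbabilityTheory.cond
  rw [Measure.map_smul, hrestrict, Real.map_volume_mul_left hr.ne', Measure.restrict_smul,
    smul_smul]
  congr 1
  rw [abs_of_pos (inv_pos.2 hr), Real.volume_Icc, Real.volume_Icc, ← ENNReal.ofReal_inv_of_pos
    (by norm_num), ← ENNReal.ofReal_inv_of_pos (by linarith),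
    ← ENNReal.ofReal_mul (by norm_num)]
  congr 1
  field_simp

theorem map_dilateLine_uniformLine {r : ℝ} (hr : 0 < r) :
    (uniformLine 1).map (dilateLine r) = uniformLine r := by
  have := isProbabilityMeasure_cond_Icc_symm one_pos
  rw [uniformLine_eq_prod one_pos, uniformLine_eq_prod hr, ← map_mul_cond_Icc_symm hr]
  have h := Measure.map_prod_map (ProbabilityTheory.cond (volume : Measure ℝ) (Set.Icc (-1) 1))
    (ProbabilityTheory.cond (volume : Measure ℝ) (Set.Icc 0 Real.pi))
    (f := (r * ·)) (g := id) (by fun_prop) measurable_id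
  rw [Measure.map_id] at h
  rw [h]
  rfl

/-- This is the source of the Poisson mean `2 λ r`: the offsets fill an interval of length `2 r`,
and the angle already has a probability law. -/
theorem lineIntensity_restrict_lineWindow {lam r : ℝ} (hlam : 0 < lam) (hr : 0 < r) :
    (lineIntensity lam).restrict (lineWindow r) = ENNReal.ofReal (2 * lam * r) • uniformLine r := by
  have hIcc : (volume : Measure ℝ).restrict (Set.Icc (-r) r) =
      ENNReal.ofReal (2 * r) • ProbabilityTheory.cond volume (Set.Icc (-r) r) := by
    unfold ProbabilityTheory.cond
    rw [smul_smul, Real.volume_Icc, show r - -r = 2 * r by ring, ENNReal.mul_inv_cancel, one_smul]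
    · simpa using hr
    · exact ENNReal.ofReal_ne_top
  have hpi : (ProbabilityTheory.cond (volume : Measure ℝ) (Set.Icc 0 Real.pi)).restrict
      (Set.Icc 0 Real.pi) = ProbabilityTheory.cond volume (Set.Icc 0 Real.pi) := by
    unfold ProbabilityTheory.cond
    rw [Measure.restrict_smul, Measure.restrict_restrict measurableSet_Icc, Set.inter_self]
  unfold lineIntensity lineWindow
  rw [Measure.restrict_smul, ← Measure.prod_restrict, hpi, hIcc, Measure.prod_smul_left, smul_smul,
    ← uniformLine_eq_prod hr, ← ENNReal.ofReal_mul hlam.le]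
  congr 2
  ring

/-! ### The conditional mean of the crossing kernel -/

/-- A point of the first line is its foot point plus `t` times its direction, and it lies in the
disc iff `t² ≤ 1 - x.1²`. With `d` the difference of the angles, it lies on the second line iff `y.1
= x.1 cos d + t sin d`. -/
theorem lines_meet_iff {x y : ℝ × ℝ} (hx : x.1 ∈ Set.Icc (-1 : ℝ) 1) :
    (planarLine x ∩ planarLine y ∩ Metric.closedBall 0 1).Nonempty ↔
      |y.1 - x.1 * Real.cos (y.2 - x.2)| ≤ √(1 - x.1 ^ 2) * |Real.sin (y.2 - x.2)| := by
  have hs : 0 ≤ 1 - x.1 ^ 2 := by nlinarith [hx.1, hx.2]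
  have e1 := Real.sin_sq_add_cos_sq x.2
  constructor
  · rintro ⟨z, ⟨h1, h2⟩, h3⟩
    simp only [planarLine, Set.mem_ofPred_eq] at h1 h2
    rw [mem_closedBall_zero_iff, EuclideanSpace.norm_eq, Real.sqrt_le_one] at h3
    simp only [Fin.sum_univ_two, Real.norm_eq_abs, sq_abs] at h3
    set t := z 1 * Real.cos x.2 - z 0 * Real.sin x.2 with ht
    have hzt : z 0 ^ 2 + z 1 ^ 2 = x.1 ^ 2 + t ^ 2 := by
      rw [ht, ← h1]; linear_combination -(z 0 ^ 2 + z 1 ^ 2) * e1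
    have : y.1 - x.1 * Real.cos (y.2 - x.2) = t * Real.sin (y.2 - x.2) := by
      rw [Real.cos_sub, Real.sin_sub, ht, ← h1, ← h2]
      linear_combination -(z 0 * Real.cos y.2 + z 1 * Real.sin y.2) * e1
    rw [this, abs_mul]
    gcongr
    apply Real.abs_le_sqrt
    linarith
  · intro h
    set d := y.2 - x.2 with hd
    -- If `sin d = 0`, division by zero gives `t = 0`. This is still the right witness: the
    -- hypothesis then makes the two lines coincide, and the foot point is common to both.
    set t := (y.1 - x.1 * Real.cos d) / Real.sin d with ht
    have htd : t * Real.sin d = y.1 - x.1 * Real.cos d := by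
      by_cases h0 : Real.sin d = 0
      · rw [h0, abs_zero, mul_zero, abs_nonpos_iff] at h
        rw [h0, h, mul_zero]
      · rw [ht, div_mul_cancel₀ _ h0]
    have hts : t ^ 2 ≤ 1 - x.1 ^ 2 := by
      by_cases h0 : Real.sin d = 0
      · rw [ht, h0, div_zero]; simpa using hs
      · rw [← htd, abs_mul, mul_le_mul_iff_left₀ (abs_pos.2 h0)] at h
        rw [← Real.sq_sqrt hs, ← sq_abs t]
        gcongr
    have hy : y.2 = x.2 + d := by rw [hd]; ring
    refine ⟨!₂[x.1 * Real.cos x.2 - t * Real.sin x.2, x.1 * Real.sin x.2 + t * Real.cos x.2],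
      ⟨?_, ?_⟩, ?_⟩
    · simp only [planarLine, Set.mem_ofPred_eq]
      simp only [Matrix.cons_val_zero, Matrix.cons_val_one]
      linear_combination x.1 * e1
    · simp only [planarLine, Set.mem_ofPred_eq]
      simp only [Matrix.cons_val_zero, Matrix.cons_val_one]
      rw [hy, Real.cos_add, Real.sin_add]
      linear_combination (x.1 * Real.cos d + t * Real.sin d) * e1 + htd
    · rw [mem_closedBall_zero_iff, EuclideanSpace.norm_eq, Real.sqrt_le_one]
      simp only [Fin.sum_univ_two, Real.norm_eq_abs, sq_abs]
      simp only [Matrix.cons_val_zero, Matrix.cons_val_one]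
      nlinarith

/-- Cauchy–Schwarz for the unit vectors `(|p|, √(1 - p²))` and `(|cos d|, |sin d|)`. It ensures that
the interval of crossing offsets is not truncated by `[-1, 1]`. -/
theorem chord_projection_subset {p : ℝ} (hp : p ∈ Set.Icc (-1 : ℝ) 1) (d : ℝ) :
    |p * Real.cos d| + √(1 - p ^ 2) * |Real.sin d| ≤ 1 := by
  have hs : 0 ≤ 1 - p ^ 2 := by nlinarith [hp.1, hp.2]
  have h1 := Real.sin_sq_add_cos_sq d
  have h2 : √(1 - p ^ 2) ^ 2 = 1 - |p| ^ 2 := by rw [Real.sq_sqrt hs, sq_abs]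
  rw [abs_mul]
  rw [← sq_abs (Real.sin d), ← sq_abs (Real.cos d)] at h1
  nlinarith [sq_nonneg (|p| - |Real.cos d|), sq_nonneg (√(1 - p ^ 2) - |Real.sin d|)]

theorem integral_cond_Icc {c d : ℝ} (hcd : c < d) (g : ℝ → ℝ) :
    ∫ t, g t ∂ProbabilityTheory.cond volume (Set.Icc c d) = (d - c)⁻¹ * ∫ t in c..d, g t := by
  unfold ProbabilityTheory.cond
  rw [integral_smul_measure, Real.volume_Icc, ENNReal.toReal_inv,
    ENNReal.toReal_ofReal (by linarith), intervalIntegral.integral_of_le hcd.le,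
    integral_Icc_eq_integral_Ioc, smul_eq_mul]

theorem integral_cond_Icc_indicator_abs_le {c w : ℝ} (hw : 0 ≤ w) (hcw : |c| + w ≤ 1) :
    ∫ t, (if |t - c| ≤ w then (1 : ℝ) else 0) ∂ProbabilityTheory.cond volume (Set.Icc (-1) 1) =
      w := by
  have h1 : (fun t : ℝ => if |t - c| ≤ w then (1 : ℝ) else 0) =
      (Set.Icc (c - w) (c + w)).indicator 1 := by
    ext t
    simp only [Set.indicator_apply, Set.mem_Icc, abs_le, Pi.one_apply]
    congr 1
    exact propext ⟨fun h => ⟨by linarith, by linarith⟩, fun h => ⟨by linarith, by linarith⟩⟩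
  have h2 : Set.Icc (-1 : ℝ) 1 ∩ Set.Icc (c - w) (c + w) = Set.Icc (c - w) (c + w) := by
    apply Set.inter_eq_right.2
    apply Set.Icc_subset_Icc <;> linarith [neg_abs_le c, le_abs_self c]
  rw [h1, integral_indicator_one measurableSet_Icc, measureReal_def,
    ProbabilityTheory.cond_apply measurableSet_Icc, h2, Real.volume_Icc, Real.volume_Icc,
    ENNReal.toReal_mul, ENNReal.toReal_inv, ENNReal.toReal_ofReal (by norm_num),
    ENNReal.toReal_ofReal (by linarith)]
  ring

/-- The integral of `|sin (γ' - γ)|` over the angles `γ'` for which the crossing kernel does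
not vanish. -/
noncomputable def admissibleWidth (a b γ : ℝ) : ℝ :=
  if γ ≤ a then 2 - Real.cos γ - Real.cos (b - γ)
  else if γ ≤ b then Real.cos (γ - a) - Real.cos γ else 0

theorem integral_ite_le {c d e : ℝ} (hcd : c ≤ d) (hde : d ≤ e) (g : ℝ → ℝ) :
    ∫ t in c..e, (if t ≤ d then g t else 0) = ∫ t in c..d, g t := by
  have h : (fun t => if t ≤ d then g t else 0) = (Set.Iic d).indicator g := by
    ext t; simp [Set.indicator_apply]
  rw [h, intervalIntegral.integral_of_le (hcd.trans hde), intervalIntegral.integral_of_le hcd,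
    setIntegral_indicator measurableSet_Iic, Set.Ioc_inter_Iic, min_eq_right hde]

theorem integral_abs_sin_sub_of_le {c γ : ℝ} (hc : 0 ≤ c) (hcγ : c ≤ γ) (hγ : γ ≤ Real.pi) :
    ∫ t in (0 : ℝ)..c, |Real.sin (t - γ)| = Real.cos (γ - c) - Real.cos γ := by
  have h : ∫ t in (0 : ℝ)..c, |Real.sin (t - γ)| = ∫ t in (0 : ℝ)..c, Real.sin (γ - t) := by
    apply intervalIntegral.integral_congr
    intro t ht
    rw [Set.uIcc_of_le hc] at ht
    dsimp only
    rw [← neg_sub, Real.sin_neg, abs_neg, abs_of_nonneg]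
    exact Real.sin_nonneg_of_nonneg_of_le_pi (by linarith [ht.2]) (by linarith [ht.1])
  rw [h, intervalIntegral.integral_comp_sub_left (fun t => Real.sin t), integral_sin, sub_zero]

theorem integral_abs_sin_sub_of_ge {c γ : ℝ} (hγ : 0 ≤ γ) (hcγ : γ ≤ c) (hc : c ≤ Real.pi) :
    ∫ t in (0 : ℝ)..c, |Real.sin (t - γ)| = 2 - Real.cos γ - Real.cos (c - γ) := by
  have hi : ∀ u v : ℝ, IntervalIntegrable (fun t => |Real.sin (t - γ)|) volume u v :=
    fun u v => (by fun_prop : Continuous fun t => |Real.sin (t - γ)|).intervalIntegrable u v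
  have h : ∫ t in γ..c, |Real.sin (t - γ)| = ∫ t in γ..c, Real.sin (t - γ) := by
    apply intervalIntegral.integral_congr
    intro t ht
    rw [Set.uIcc_of_le hcγ] at ht
    exact abs_of_nonneg
      (Real.sin_nonneg_of_nonneg_of_le_pi (by linarith [ht.1]) (by linarith [ht.2]))
  rw [← intervalIntegral.integral_add_adjacent_intervals (hi 0 γ) (hi γ c),
    integral_abs_sin_sub_of_le hγ le_rfl (hcγ.trans hc), h,
    intervalIntegral.integral_comp_sub_right (fun t => Real.sin t), integral_sin]
  simp
  ring

/-- If `γ ≤ a`, the other angle may be anything up to `b`. If `a < γ ≤ b`, the other angle has to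
supply the minimum and is at most `a`. If `γ > b`, no angle is admissible. -/
theorem integral_admissible_abs_sin {a b γ : ℝ} (ha : 0 ≤ a) (hab : a < b) (hb : b ≤ Real.pi)
    (hγ : γ ∈ Set.Icc 0 Real.pi) :
    ∫ t in (0 : ℝ)..Real.pi,
      (if min γ t ∈ Set.Icc 0 a ∧ max γ t ∈ Set.Icc 0 b then |Real.sin (t - γ)| else 0) =
      admissibleWidth a b γ := by
  unfold admissibleWidth
  split_ifs with h1 h2
  · rw [← integral_abs_sin_sub_of_ge hγ.1 (h1.trans hab.le) hb,
      ← integral_ite_le (ha.trans hab.le) hb]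
    apply intervalIntegral.integral_congr
    intro t ht
    rw [Set.uIcc_of_le Real.pi_pos.le] at ht
    dsimp only
    congr 1
    simp only [Set.mem_Icc, le_min_iff, le_max_iff, min_le_iff, max_le_iff, eq_iff_iff]
    have := ht.1; have := hγ.1
    constructor
    · tauto
    · intro h; refine ⟨⟨⟨?_, ?_⟩, ?_⟩, ?_, ?_, ?_⟩ <;> first | assumption | (left; assumption) | linarith
  · push Not at h1
    rw [← integral_abs_sin_sub_of_le ha h1.le hγ.2, ← integral_ite_le ha (hab.le.trans hb)]
    apply intervalIntegral.integral_congr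
    intro t ht
    rw [Set.uIcc_of_le Real.pi_pos.le] at ht
    dsimp only
    congr 1
    simp only [Set.mem_Icc, le_min_iff, le_max_iff, min_le_iff, max_le_iff, eq_iff_iff]
    have := ht.1; have := hγ.1
    constructor
    · rintro ⟨⟨-, h | h⟩, -⟩
      · linarith
      · exact h
    · intro h; refine ⟨⟨⟨?_, ?_⟩, ?_⟩, ?_, ?_, ?_⟩ <;>
        first | assumption | (left; assumption) | (right; assumption) | linarith
  · push Not at h1 h2
    trans ∫ _ in (0 : ℝ)..Real.pi, (0 : ℝ)
    swap
    · simp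
    apply intervalIntegral.integral_congr
    intro t _
    dsimp only
    rw [if_neg]
    rintro ⟨-, h⟩
    linarith [h.2, le_max_left γ t]

theorem integrable_of_mem_Icc {α : Type*} [MeasurableSpace α] {μ : Measure α} [IsFiniteMeasure μ]
    {f : α → ℝ} (c d : ℝ) (hf : Measurable f) (h : ∀ x, f x ∈ Set.Icc c d) : Integrable f μ :=
  Integrable.of_mem_Icc c d hf.aemeasurable (ae_of_all _ h)

/-- The conditional mean of the crossing kernel of the unit disc, given one of the two lines. -/
theorem integral_crossKernel_one {a b : ℝ} (ha : 0 ≤ a) (hab : a < b) (hb : b ≤ Real.pi)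
    {x : ℝ × ℝ} (hx : x ∈ lineWindow 1) :
    ∫ y, crossKernel 1 a b x y ∂uniformLine 1 =
      √(1 - x.1 ^ 2) * (Real.pi⁻¹ * admissibleWidth a b x.2) := by
  have := isProbabilityMeasure_cond_Icc_symm one_pos
  have hint : Integrable (fun y => crossKernel 1 a b x y)
      ((ProbabilityTheory.cond volume (Set.Icc (-1 : ℝ) 1)).prod
        (ProbabilityTheory.cond volume (Set.Icc 0 Real.pi))) :=
    integrable_of_mem_Icc 0 1 (measurable_crossKernel_right 1 a b x) fun y => crossKernel_mem_Icc 1 a b x y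
  -- The offset is integrated first: at a fixed admissible angle the kernel is the indicator of an
  -- interval in `[-1, 1]`, whose probability is its half-length.
  rw [uniformLine_eq_prod one_pos, integral_prod_symm _ hint]
  have inner (g : ℝ) : ∫ p, crossKernel 1 a b x (p, g)
        ∂ProbabilityTheory.cond volume (Set.Icc (-1 : ℝ) 1) =
      √(1 - x.1 ^ 2) * (if min x.2 g ∈ Set.Icc 0 a ∧ max x.2 g ∈ Set.Icc 0 b
        then |Real.sin (g - x.2)| else 0) := by
    by_cases h : min x.2 g ∈ Set.Icc 0 a ∧ max x.2 g ∈ Set.Icc 0 b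
    · rw [if_pos h, ← integral_cond_Icc_indicator_abs_le (by positivity)
        (chord_projection_subset hx.1 (g - x.2))]
      refine integral_congr_ae (ae_of_all _ fun p => ?_)
      have := lines_meet_iff (y := (p, g)) hx.1
      dsimp only at this ⊢
      by_cases hc : |p - x.1 * Real.cos (g - x.2)| ≤ √(1 - x.1 ^ 2) * |Real.sin (g - x.2)|
      · rw [if_pos hc, crossKernel, if_pos ⟨this.2 hc, h⟩]
      · rw [if_neg hc, crossKernel, if_neg fun hn => hc (this.1 hn.1)]
    · have h0 (p : ℝ) : crossKernel 1 a b x (p, g) = 0 := by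
        rw [crossKernel, if_neg fun hn => h hn.2]
      simp only [h0, integral_zero, if_neg h, mul_zero]
  simp only [inner]
  rw [integral_const_mul, integral_cond_Icc Real.pi_pos, sub_zero,
    integral_admissible_abs_sin ha hab hb hx.2]

/-! ### The first two moments of the crossing kernel -/

theorem integral_prod_eq_integral_condMean {α : Type*} [MeasurableSpace α] {U : Measure α}
    [IsProbabilityMeasure U] {f : α → α → ℝ} (hf : Measurable fun q : α × α => f q.1 q.2)
    (hb : ∀ x y, f x y ∈ Set.Icc (0 : ℝ) 1) :
    ∫ z : α × α, f z.1 z.2 ∂(U.prod U) = ∫ x, (∫ y, f x y ∂U) ∂U := by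
  have hint : Integrable (fun z : α × α => f z.1 z.2) (U.prod U) :=
    integrable_of_mem_Icc 0 1 hf fun z => hb z.1 z.2
  exact integral_prod _ hint

/-- Given the shared middle variable, the two factors are independent, and by symmetry they have the
same conditional mean. -/
theorem integral_prod_mul_eq_integral_condMean_sq {α : Type*} [MeasurableSpace α] {U : Measure α}
    [IsProbabilityMeasure U] {f : α → α → ℝ} (hf : Measurable fun q : α × α => f q.1 q.2)
    (hb : ∀ x y, f x y ∈ Set.Icc (0 : ℝ) 1) (hs : ∀ x y, f x y = f y x) :
    ∫ z : α × α × α, f z.1 z.2.1 * f z.2.1 z.2.2 ∂(U.prod (U.prod U)) =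
      ∫ x, (∫ y, f x y ∂U) ^ 2 ∂U := by
  have hm1 : Measurable fun z : α × α × α => f z.1 z.2.1 :=
    hf.comp (measurable_fst.prodMk (measurable_fst.comp measurable_snd))
  have hm2 : Measurable fun z : α × α × α => f z.2.1 z.2.2 := hf.comp measurable_snd
  have hint : Integrable (fun z : α × α × α => f z.1 z.2.1 * f z.2.1 z.2.2)
      (U.prod (U.prod U)) :=
    integrable_of_mem_Icc 0 1 (hm1.mul hm2) fun z =>
      ⟨mul_nonneg (hb _ _).1 (hb _ _).1, mul_le_one₀ (hb _ _).2 (hb _ _).1 (hb _ _).2⟩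
  have hh : Measurable fun x => ∫ y, f x y ∂U :=
    (hf.stronglyMeasurable.integral_prod_right (ν := U)).measurable
  have hhb (x : α) : ∫ y, f x y ∂U ∈ Set.Icc (0 : ℝ) 1 := by
    refine ⟨integral_nonneg fun y => (hb x y).1, ?_⟩
    have := integral_mono_of_nonneg (μ := U) (f := fun y => f x y) (g := fun _ => 1)
      (ae_of_all _ fun y => (hb x y).1) (integrable_const _) (ae_of_all _ fun y => (hb x y).2)
    simpa using this
  have hint2 : Integrable (fun w : α × α => (∫ y, f w.1 y ∂U) * f w.1 w.2) (U.prod U) :=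
    integrable_of_mem_Icc 0 1 ((hh.comp measurable_fst).mul hf) fun z =>
      ⟨mul_nonneg (hhb _).1 (hb _ _).1, mul_le_one₀ (hhb _).2 (hb _ _).1 (hb _ _).2⟩
  rw [integral_prod_symm _ hint]
  simp only [integral_mul_const]
  have hsw (x : α) : ∫ y, f y x ∂U = ∫ y, f x y ∂U := by simp only [hs]
  simp only [hsw]
  rw [integral_prod _ hint2]
  simp only [integral_const_mul, sq]

theorem ae_mem_lineWindow_one : ∀ᵐ x ∂uniformLine 1, x ∈ lineWindow 1 := by
  unfold uniformLine ProbabilityTheory.cond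
  exact Measure.ae_smul_measure
    (ae_restrict_mem (measurableSet_Icc.prod measurableSet_Icc)) _

/-- The condition `φ 0 = 0` removes the angles beyond `b`. The cases `φ = id` and `φ = (· ^ 2)` give
the first and second moment. -/
theorem integral_comp_admissibleWidth {a b : ℝ} (ha : 0 ≤ a) (hab : a < b) (hb : b ≤ Real.pi)
    {φ : ℝ → ℝ} (hφ : Continuous φ) (hφ0 : φ 0 = 0) :
    ∫ γ in (0 : ℝ)..Real.pi, φ (admissibleWidth a b γ) =
      (∫ γ in (0 : ℝ)..a, φ (2 - Real.cos γ - Real.cos (b - γ))) +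
        ∫ γ in a..b, φ (Real.cos (γ - a) - Real.cos γ) := by
  have e1 : Set.EqOn (fun γ => φ (admissibleWidth a b γ))
      (fun γ => φ (2 - Real.cos γ - Real.cos (b - γ))) (Set.uIoc 0 a) := by
    intro γ hγ
    rw [Set.uIoc_of_le ha] at hγ
    simp only [admissibleWidth, if_pos hγ.2]
  have e2 : Set.EqOn (fun γ => φ (admissibleWidth a b γ))
      (fun γ => φ (Real.cos (γ - a) - Real.cos γ)) (Set.uIoc a b) := by
    intro γ hγ
    rw [Set.uIoc_of_le hab.le] at hγ
    simp only [admissibleWidth, if_pos hγ.2, if_neg (not_le.2 hγ.1)]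
  have e3 : Set.EqOn (fun γ => φ (admissibleWidth a b γ)) (fun _ => 0) (Set.uIoc b Real.pi) := by
    intro γ hγ
    rw [Set.uIoc_of_le hb] at hγ
    simp only [admissibleWidth, if_neg (not_le.2 hγ.1), if_neg (not_le.2 (hab.trans hγ.1)), hφ0]
  have i1 : IntervalIntegrable (fun γ => φ (admissibleWidth a b γ)) volume 0 a :=
    (Continuous.intervalIntegrable (by fun_prop) _ _).congr e1.symm
  have i2 : IntervalIntegrable (fun γ => φ (admissibleWidth a b γ)) volume a b :=
    (Continuous.intervalIntegrable (by fun_prop) _ _).congr e2.symm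
  have i3 : IntervalIntegrable (fun γ => φ (admissibleWidth a b γ)) volume b Real.pi :=
    (Continuous.intervalIntegrable (by fun_prop) _ _).congr e3.symm
  rw [← intervalIntegral.integral_add_adjacent_intervals (i1.trans i2) i3,
    ← intervalIntegral.integral_add_adjacent_intervals i1 i2,
    intervalIntegral.integral_congr_ae (ae_of_all _ e1),
    intervalIntegral.integral_congr_ae (ae_of_all _ e2),
    intervalIntegral.integral_congr_ae (ae_of_all _ e3)]
  simp

theorem integral_admissibleWidth {a b : ℝ} (ha : 0 ≤ a) (hab : a < b) (hb : b ≤ Real.pi) :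
    ∫ γ in (0 : ℝ)..Real.pi, admissibleWidth a b γ =
      2 * (a - Real.sin b + Real.sin (b - a)) := by
  rw [integral_comp_admissibleWidth ha hab hb (φ := fun x => x) continuous_id rfl]
  have h1 : ∫ γ in (0 : ℝ)..a, (2 - Real.cos γ - Real.cos (b - γ)) =
      (2 * a - Real.sin a + Real.sin (b - a)) - (2 * 0 - Real.sin 0 + Real.sin (b - 0)) := by
    refine intervalIntegral.integral_eq_sub_of_hasDerivAt
      (f := fun γ => 2 * γ - Real.sin γ + Real.sin (b - γ)) (fun γ _ => ?_)
      (Continuous.intervalIntegrable (by fun_prop) _ _)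
    have := (((hasDerivAt_id γ).const_mul 2).sub (Real.hasDerivAt_sin γ)).add
      (((hasDerivAt_id γ).const_sub b).sin)
    convert! this using 1
    simp; ring
  have h2 : ∫ γ in a..b, (Real.cos (γ - a) - Real.cos γ) =
      (Real.sin (b - a) - Real.sin b) - (Real.sin (a - a) - Real.sin a) := by
    refine intervalIntegral.integral_eq_sub_of_hasDerivAt
      (f := fun γ => Real.sin (γ - a) - Real.sin γ) (fun γ _ => ?_)
      (Continuous.intervalIntegrable (by fun_prop) _ _)
    have := (((hasDerivAt_id γ).sub_const a).sin).sub (Real.hasDerivAt_sin γ)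
    convert! this using 1
    simp
  rw [h1, h2]
  simp
  ring

theorem integral_admissibleWidth_sq {a b : ℝ} (ha : 0 ≤ a) (hab : a < b) (hb : b ≤ Real.pi) :
    ∫ γ in (0 : ℝ)..Real.pi, admissibleWidth a b γ ^ 2 =
      4 * a + b + Real.sin b * Real.cos b - 7 / 2 * (Real.sin a + Real.sin b)
        + 4 * Real.sin (b - a) + a * Real.cos b - (b - a) * Real.cos a
        + 1 / 2 * (Real.sin (2 * a - b) - Real.sin (2 * b - a)) := by
  rw [integral_comp_admissibleWidth ha hab hb (φ := fun x => x ^ 2) (by fun_prop) (by simp)]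
  -- `F` and `G` are antiderivatives of the two squares, expanded with `2 cos u cos v = cos (u + v)
  -- + cos (u - v)` for the mixed term.
  set F : ℝ → ℝ := fun γ => 5 * γ + Real.sin γ * Real.cos γ / 2
    - Real.sin (b - γ) * Real.cos (b - γ) / 2 - 4 * Real.sin γ + 4 * Real.sin (b - γ)
    + γ * Real.cos b + Real.sin (2 * γ - b) / 2 with hF
  set G : ℝ → ℝ := fun γ => γ + Real.sin (γ - a) * Real.cos (γ - a) / 2
    + Real.sin γ * Real.cos γ / 2 - γ * Real.cos a - Real.sin (2 * γ - a) / 2 with hG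
  have h1 : ∫ γ in (0 : ℝ)..a, (2 - Real.cos γ - Real.cos (b - γ)) ^ 2 = F a - F 0 := by
    refine intervalIntegral.integral_eq_sub_of_hasDerivAt (fun γ _ => ?_)
      (Continuous.intervalIntegrable (by fun_prop) _ _)
    have d1 := (hasDerivAt_id γ)
    have d2 := d1.const_sub b
    have := (((((((d1.const_mul 5).add ((d1.sin.mul d1.cos).div_const 2)).sub
      ((d2.sin.mul d2.cos).div_const 2)).sub (d1.sin.const_mul 4)).add
      (d2.sin.const_mul 4)).add (d1.mul_const (Real.cos b))).add
      (((d1.const_mul 2).sub_const b).sin.div_const 2))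
    convert! this using 1
    simp only [id]
    -- With `v = b - γ` as an independent variable, all the angles are sums or differences of `γ`
    -- and `v`. The claim becomes a polynomial identity modulo `sin² + cos² = 1`.
    have hb' : b = γ + (b - γ) := by ring
    have hb2 : 2 * γ - b = γ - (b - γ) := by ring
    rw [hb2]
    generalize b - γ = v at *
    rw [hb', Real.cos_add, Real.cos_sub]
    linear_combination (1 / 2) * Real.sin_sq_add_cos_sq γ + (1 / 2) * Real.sin_sq_add_cos_sq v
  have h2 : ∫ γ in a..b, (Real.cos (γ - a) - Real.cos γ) ^ 2 = G b - G a := by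
    refine intervalIntegral.integral_eq_sub_of_hasDerivAt (fun γ _ => ?_)
      (Continuous.intervalIntegrable (by fun_prop) _ _)
    have d1 := (hasDerivAt_id γ)
    have d2 := d1.sub_const a
    have := (((((d1.add ((d2.sin.mul d2.cos).div_const 2)).add
      ((d1.sin.mul d1.cos).div_const 2)).sub (d1.mul_const (Real.cos a))).sub
      (((d1.const_mul 2).sub_const a).sin.div_const 2)))
    convert! this using 1
    simp only [id]
    have ha' : a = γ - (γ - a) := by ring
    have ha2 : 2 * γ - a = γ + (γ - a) := by ring
    rw [ha2]
    generalize γ - a = v at *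
    rw [ha', Real.cos_add, Real.cos_sub]
    linear_combination (1 / 2) * Real.sin_sq_add_cos_sq γ + (1 / 2) * Real.sin_sq_add_cos_sq v
  rw [h1, h2, hF, hG]
  simp only [sub_self, sub_zero, Real.sin_zero, mul_zero, zero_sub, Real.sin_neg, zero_mul,
    show 2 * a - a = a by ring]
  ring

theorem integral_uniformLine_mul {g h : ℝ → ℝ} :
    ∫ x : ℝ × ℝ, g x.1 * h x.2 ∂uniformLine 1 =
      (2⁻¹ * ∫ p in (-1 : ℝ)..1, g p) * (Real.pi⁻¹ * ∫ γ in (0 : ℝ)..Real.pi, h γ) := by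
  have := isProbabilityMeasure_cond_Icc_symm one_pos
  rw [uniformLine_eq_prod one_pos, integral_prod_mul, integral_cond_Icc (by norm_num),
    integral_cond_Icc Real.pi_pos, sub_zero]
  norm_num

theorem muB_eq_integral (a b : ℝ) :
    muB a b = ∫ x, (∫ y, crossKernel 1 a b x y ∂uniformLine 1) ∂uniformLine 1 := by
  have := isProbabilityMeasure_uniformLine one_pos
  exact integral_prod_eq_integral_condMean (measurable_crossKernel 1 a b)
    (crossKernel_mem_Icc 1 a b)

theorem sigmaB_eq_integral (a b : ℝ) :
    sigmaB a b = ∫ x, (∫ y, crossKernel 1 a b x y ∂uniformLine 1) ^ 2 ∂uniformLine 1 := by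
  have := isProbabilityMeasure_uniformLine one_pos
  exact integral_prod_mul_eq_integral_condMean_sq (measurable_crossKernel 1 a b)
    (crossKernel_mem_Icc 1 a b) (crossKernel_comm 1 a b)

/-- Offset and angle of a uniform line are independent and the conditional mean is a product, so the
integral factors. The offset contributes half the area `π / 2` of a half disc. -/
theorem muB_eq {a b : ℝ} (ha : 0 ≤ a) (hab : a < b) (hb : b ≤ Real.pi) :
    muB a b = 1 / (2 * Real.pi) * (a - Real.sin b + Real.sin (b - a)) := by
  have h : ∀ᵐ x ∂uniformLine 1, ∫ y, crossKernel 1 a b x y ∂uniformLine 1 =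
      √(1 - x.1 ^ 2) * (Real.pi⁻¹ * admissibleWidth a b x.2) := by
    filter_upwards [ae_mem_lineWindow_one] with x hx using integral_crossKernel_one ha hab hb hx
  rw [muB_eq_integral, integral_congr_ae h, integral_uniformLine_mul
    (g := fun p => √(1 - p ^ 2)) (h := fun γ => Real.pi⁻¹ * admissibleWidth a b γ),
    integral_sqrt_one_sub_sq, intervalIntegral.integral_const_mul,
    integral_admissibleWidth ha hab hb]
  field_simp

theorem sigmaB_eq {a b : ℝ} (ha : 0 ≤ a) (hab : a < b) (hb : b ≤ Real.pi) :
    sigmaB a b = 2 / (3 * Real.pi ^ 3) *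
      (4 * a + b + Real.sin b * Real.cos b - 7 / 2 * (Real.sin a + Real.sin b)
        + 4 * Real.sin (b - a) + a * Real.cos b - (b - a) * Real.cos a
        + 1 / 2 * (Real.sin (2 * a - b) - Real.sin (2 * b - a))) := by
  have h : ∀ᵐ x ∂uniformLine 1, (∫ y, crossKernel 1 a b x y ∂uniformLine 1) ^ 2 =
      (1 - x.1 ^ 2) * ((Real.pi⁻¹) ^ 2 * admissibleWidth a b x.2 ^ 2) := by
    filter_upwards [ae_mem_lineWindow_one] with x hx
    have hs : 0 ≤ 1 - x.1 ^ 2 := by nlinarith [hx.1.1, hx.1.2]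
    rw [integral_crossKernel_one ha hab hb hx, mul_pow, Real.sq_sqrt hs, mul_pow]
  have hp : ∫ p in (-1 : ℝ)..1, (1 - p ^ 2) = 4 / 3 := by
    rw [intervalIntegral.integral_sub (by simp) (by simp), integral_pow]
    norm_num
  rw [sigmaB_eq_integral, integral_congr_ae h, integral_uniformLine_mul
    (g := fun p => 1 - p ^ 2) (h := fun γ => (Real.pi⁻¹) ^ 2 * admissibleWidth a b γ ^ 2),
    hp, intervalIntegral.integral_const_mul, integral_admissibleWidth_sq ha hab hb]
  field_simp
  norm_num

/-! ### Independence of the radius, and the variance inequality. -/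

theorem kernelMean_eq_muB {r : ℝ} (hr : 0 < r) (a b : ℝ) : kernelMean r a b = muB a b := by
  have := isProbabilityMeasure_uniformLine one_pos
  have hd := measurable_dilateLine r
  unfold kernelMean muB kernelMean
  rw [← map_dilateLine_uniformLine hr, Measure.map_prod_map _ _ hd hd,
    integral_map (hd.prodMap hd).aemeasurable (measurable_crossKernel r a b).aestronglyMeasurable]
  simp only [Prod.map_fst, Prod.map_snd, crossKernel_dilateLine hr]

theorem integral_prod_mul_map {α : Type*} [MeasurableSpace α] {U : Measure α}
    [IsProbabilityMeasure U] {f : α → α → ℝ} (hf : Measurable fun q : α × α => f q.1 q.2)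
    {d : α → α} (hd : Measurable d) :
    ∫ z : α × α × α, f z.1 z.2.1 * f z.2.1 z.2.2
        ∂((U.map d).prod ((U.map d).prod (U.map d))) =
      ∫ z : α × α × α, f (d z.1) (d z.2.1) * f (d z.2.1) (d z.2.2) ∂(U.prod (U.prod U)) := by
  have hm1 : Measurable fun z : α × α × α => f z.1 z.2.1 :=
    hf.comp (measurable_fst.prodMk (measurable_fst.comp measurable_snd))
  have hm2 : Measurable fun z : α × α × α => f z.2.1 z.2.2 := hf.comp measurable_snd
  have hm : Measurable fun z : α × α × α => f z.1 z.2.1 * f z.2.1 z.2.2 := hm1.mul hm2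
  rw [Measure.map_prod_map _ _ hd hd, Measure.map_prod_map _ _ hd (hd.prodMap hd),
    integral_map (hd.prodMap (hd.prodMap hd)).aemeasurable hm.aestronglyMeasurable]
  rfl

theorem kernelSecondMoment_eq_sigmaB {r : ℝ} (hr : 0 < r) (a b : ℝ) :
    kernelSecondMoment r a b = sigmaB a b := by
  have := isProbabilityMeasure_uniformLine one_pos
  have h := integral_prod_mul_map (U := uniformLine 1) (measurable_crossKernel r a b)
    (measurable_dilateLine r)
  rw [map_dilateLine_uniformLine hr] at h
  simp only [crossKernel_dilateLine hr] at h
  exact h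

/-- The difference of the two sides is the variance of the conditional mean. -/
theorem muB_sq_le_sigmaB (a b : ℝ) : muB a b ^ 2 ≤ sigmaB a b := by
  have := isProbabilityMeasure_uniformLine one_pos
  have hm : Measurable fun x => ∫ y, crossKernel 1 a b x y ∂uniformLine 1 :=
    ((measurable_crossKernel 1 a b).stronglyMeasurable.integral_prod_right
      (ν := uniformLine 1)).measurable
  have hL : MemLp (fun x => ∫ y, crossKernel 1 a b x y ∂uniformLine 1) 2 (uniformLine 1) := by
    refine MemLp.of_bound hm.aestronglyMeasurable 1 (ae_of_all _ fun x => ?_)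
    refine (norm_integral_le_of_norm_le_const (C := 1) (ae_of_all _ fun y => ?_)).trans (by simp)
    rw [Real.norm_of_nonneg (crossKernel_mem_Icc 1 a b x y).1]
    exact (crossKernel_mem_Icc 1 a b x y).2
  have h := variance_nonneg (fun x => ∫ y, crossKernel 1 a b x y ∂uniformLine 1) (uniformLine 1)
  rw [variance_eq_sub hL] at h
  rw [muB_eq_integral, sigmaB_eq_integral]
  simpa using h

/-! ### A central limit theorem for U-statistics of order two -/

/-- The pairs of indices `i < j` in `I`. -/
abbrev orderedPairs (I : Finset ℕ) : Finset (ℕ × ℕ) := (I ×ˢ I).filter (fun p => p.1 < p.2)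

theorem sum_sum_eq_sum_diag_add_sum_orderedPairs (I : Finset ℕ) (F : ℕ → ℕ → ℝ) :
    ∑ i ∈ I, ∑ j ∈ I, F i j =
      ∑ i ∈ I, F i i + ∑ p ∈ orderedPairs I, (F p.1 p.2 + F p.2 p.1) := by
  have h1 (G : ℕ → ℕ → ℝ) : ∑ p ∈ orderedPairs I, G p.1 p.2 =
      ∑ i ∈ I, ∑ j ∈ I, if i < j then G i j else 0 := by
    rw [orderedPairs, Finset.sum_filter, Finset.sum_product]
  have h2 : ∑ i ∈ I, F i i = ∑ i ∈ I, ∑ j ∈ I, if i = j then F i j else 0 := by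
    refine Finset.sum_congr rfl fun i hi => ?_
    rw [Finset.sum_ite_eq, if_pos hi]
  rw [Finset.sum_add_distrib, h1, h1 (fun i j => F j i), h2,
    Finset.sum_comm (f := fun i j => if i < j then F j i else 0), ← Finset.sum_add_distrib,
    ← Finset.sum_add_distrib]
  refine Finset.sum_congr rfl fun i _ => ?_
  rw [← Finset.sum_add_distrib, ← Finset.sum_add_distrib]
  refine Finset.sum_congr rfl fun j _ => ?_
  rcases lt_trichotomy i j with h | h | h
  · simp [h, h.ne, h.le]
  · simp [h]
  · simp [h, h.ne', h.le]

/-- Each index belongs to `#I - 1` pairs. -/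
theorem sum_orderedPairs_add (I : Finset ℕ) (u : ℕ → ℝ) :
    ∑ p ∈ orderedPairs I, (u p.1 + u p.2) = ((I.card : ℝ) - 1) * ∑ i ∈ I, u i := by
  have h := sum_sum_eq_sum_diag_add_sum_orderedPairs I (fun i j => u i + u j)
  have h2 : ∑ p ∈ orderedPairs I, (u p.1 + u p.2 + (u p.2 + u p.1)) =
      2 * ∑ p ∈ orderedPairs I, (u p.1 + u p.2) := by
    rw [Finset.mul_sum]
    exact Finset.sum_congr rfl fun p _ => by ring
  simp only [h2, Finset.sum_add_distrib, Finset.sum_const, nsmul_eq_mul, ← Finset.mul_sum] at h ⊢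
  linarith

theorem card_orderedPairs (I : Finset ℕ) :
    ((orderedPairs I).card : ℝ) = (I.card : ℝ) * ((I.card : ℝ) - 1) / 2 := by
  have h := sum_orderedPairs_add I (fun _ => 1)
  simp only [Finset.sum_const, nsmul_eq_mul] at h
  linarith

section UStatistic

variable {α : Type*} [MeasurableSpace α] {U : Measure α} [IsProbabilityMeasure U]

/-- The coordinate `x i` is independent of the coordinates `j`, `k`, `l`, which may coincide among
themselves. It enters only one factor, so integrating it out first gives zero. -/
theorem integral_mul_eq_zero_of_degenerate {g : α → α → ℝ}
    (hg : Measurable fun q : α × α => g q.1 q.2) {C : ℝ} (hC : ∀ x y, |g x y| ≤ C)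
    (h0 : ∀ y, ∫ x, g x y ∂U = 0) {i j k l : ℕ} (hj : i ≠ j) (hk : i ≠ k) (hl : i ≠ l) :
    ∫ x : ℕ → α, g (x i) (x j) * g (x k) (x l) ∂Measure.infinitePi (fun _ => U) = 0 := by
  classical
  set Q : Measure (ℕ → α) := Measure.infinitePi (fun _ => U) with hQ
  set T : Finset ℕ := {j, k, l} with hT
  have hjT : j ∈ T := by simp [hT]
  have hkT : k ∈ T := by simp [hT]
  have hlT : l ∈ T := by simp [hT]
  have hind : iIndepFun (fun (m : ℕ) (x : ℕ → α) => x m) Q :=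
    iIndepFun_infinitePi (X := fun _ x => x) (fun _ => measurable_id)
  have hdisj : Disjoint {i} T := by
    simp [hT, hj, hk, hl]
  have h1 := hind.indepFun_finset {i} T hdisj (fun m => measurable_pi_apply m)
  have h2 : IndepFun (fun x : ℕ → α => x i) (fun x : ℕ → α => fun m : T => x m) Q :=
    h1.comp (φ := fun w : (({i} : Finset ℕ) → α) => w ⟨i, by simp⟩) (ψ := id)
      (by fun_prop) measurable_id
  have hmT : Measurable (fun x : ℕ → α => fun m : T => x m) := by fun_prop
  have hmap := h2.map_prod_eq_prod_map_map (measurable_pi_apply i).aemeasurable hmT.aemeasurable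
  rw [hQ, Measure.infinitePi_map_eval, ← hQ] at hmap
  set V := Q.map (fun x : ℕ → α => fun m : T => x m) with hV
  have : IsProbabilityMeasure V := Measure.isProbabilityMeasure_map hmT.aemeasurable
  set F : α × (T → α) → ℝ := fun q => g q.1 (q.2 ⟨j, hjT⟩) * g (q.2 ⟨k, hkT⟩) (q.2 ⟨l, hlT⟩)
    with hF
  have hFm : Measurable F := by
    have m1 : Measurable fun q : α × (T → α) => g q.1 (q.2 ⟨j, hjT⟩) :=
      hg.comp (g := fun q : α × α => g q.1 q.2) (f := fun q : α × (T → α) =>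
        (q.1, q.2 ⟨j, hjT⟩)) (by fun_prop)
    have m2 : Measurable fun q : α × (T → α) => g (q.2 ⟨k, hkT⟩) (q.2 ⟨l, hlT⟩) :=
      hg.comp (g := fun q : α × α => g q.1 q.2) (f := fun q : α × (T → α) =>
        (q.2 ⟨k, hkT⟩, q.2 ⟨l, hlT⟩)) (by fun_prop)
    exact m1.mul m2
  have hFi : Integrable F (U.prod V) := by
    refine Integrable.of_bound hFm.aestronglyMeasurable (C * C) (ae_of_all _ fun q => ?_)
    rw [hF, Real.norm_eq_abs, abs_mul]
    exact mul_le_mul (hC _ _) (hC _ _) (abs_nonneg _) ((abs_nonneg _).trans (hC q.1 q.1))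
  have key : ∫ x : ℕ → α, g (x i) (x j) * g (x k) (x l) ∂Q = ∫ q, F q ∂(U.prod V) := by
    rw [← hmap, integral_map (by fun_prop) hFm.aestronglyMeasurable]
  rw [key, integral_prod_symm _ hFi]
  simp only [hF, integral_mul_const, h0, zero_mul, integral_zero]

/-- Two distinct pairs never share both indices, so by degeneracy their terms are orthogonal and
only the diagonal of the expanded square survives. -/
theorem integral_sq_sum_orderedPairs_le {g : α → α → ℝ}
    (hg : Measurable fun q : α × α => g q.1 q.2) {C : ℝ} (hC : ∀ x y, |g x y| ≤ C)
    (hs : ∀ x y, g x y = g y x) (h0 : ∀ y, ∫ x, g x y ∂U = 0) (I : Finset ℕ) :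
    ∫ x : ℕ → α, (∑ p ∈ orderedPairs I, g (x p.1) (x p.2)) ^ 2
      ∂Measure.infinitePi (fun _ => U) ≤ (orderedPairs I).card * C ^ 2 := by
  have hm (p : ℕ × ℕ) : Measurable fun x : ℕ → α => g (x p.1) (x p.2) :=
    hg.comp (g := fun q : α × α => g q.1 q.2) (f := fun x : ℕ → α => (x p.1, x p.2)) (by fun_prop)
  have hint (p q : ℕ × ℕ) : Integrable
      (fun x : ℕ → α => g (x p.1) (x p.2) * g (x q.1) (x q.2))
      (Measure.infinitePi (fun _ => U)) := by
    refine Integrable.of_bound ((hm p).mul (hm q)).aestronglyMeasurable (C * C)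
      (ae_of_all _ fun x => ?_)
    rw [Real.norm_eq_abs, abs_mul]
    exact mul_le_mul (hC _ _) (hC _ _) (abs_nonneg _)
      ((abs_nonneg _).trans (hC (x p.1) (x p.1)))
  simp only [sq (∑ p ∈ orderedPairs I, _), Finset.sum_mul_sum]
  rw [integral_finsetSum _ fun p _ => integrable_finsetSum _ fun q _ => hint p q]
  rw [← nsmul_eq_mul, ← Finset.sum_const]
  refine Finset.sum_le_sum fun p hp => ?_
  rw [integral_finsetSum _ fun q _ => hint p q, Finset.sum_eq_single p]
  · calc ∫ x : ℕ → α, g (x p.1) (x p.2) * g (x p.1) (x p.2) ∂Measure.infinitePi (fun _ => U)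
        ≤ ∫ _ : ℕ → α, C ^ 2 ∂Measure.infinitePi (fun _ => U) := by
          refine integral_mono (hint p p) (integrable_const _) fun x => ?_
          dsimp only
          rw [← sq, ← sq_abs]
          gcongr
          exact hC _ _
      _ = C ^ 2 := by simp
  · intro q hq hqp
    simp only [orderedPairs, Finset.mem_filter] at hp hq
    by_cases h1 : p.1 ≠ q.1 ∧ p.1 ≠ q.2
    · exact integral_mul_eq_zero_of_degenerate hg hC h0 hp.2.ne h1.1 h1.2
    · have h2 : p.2 ≠ q.1 ∧ p.2 ≠ q.2 := by
        have := hp.2; have := hq.2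
        by_contra h2
        apply hqp
        ext <;> omega
      rw [← integral_mul_eq_zero_of_degenerate hg hC h0 (i := p.2) (j := p.1) hp.2.ne' h2.1 h2.2]
      refine integral_congr_ae (ae_of_all _ fun x => ?_)
      dsimp only
      rw [hs (x p.1)]
  · exact fun h => absurd hp h

/-- The factor converts the `√n` scaling of the central limit theorem for the linear part into the
normalization of the U-statistic. For `n ≥ 2` it equals `(1 - 1 / n)^(1/4)`. -/
theorem tendsto_hajek_factor :
    Tendsto (fun n : ℕ => ((n : ℝ) - 1) * √n / ((n : ℝ) * ((n : ℝ) - 1)) ^ (3 / 4 : ℝ)) atTop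
      (nhds 1) := by
  have h1 : Tendsto (fun n : ℕ => (1 - 1 / (n : ℝ)) ^ (1 / 4 : ℝ)) atTop (nhds 1) := by
    have : Tendsto (fun n : ℕ => 1 - 1 / (n : ℝ)) atTop (nhds 1) := by
      simpa using tendsto_const_nhds.sub (tendsto_one_div_atTop_nhds_zero_nat (𝕜 := ℝ))
    simpa using this.rpow_const (p := 1 / 4) (Or.inl one_ne_zero)
  refine h1.congr' ?_
  filter_upwards [eventually_ge_atTop 2] with n hn
  have hn' : (2 : ℝ) ≤ n := by exact_mod_cast hn
  have hp : (0 : ℝ) < n := by linarith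
  have hq : (0 : ℝ) < (n : ℝ) - 1 := by linarith
  rw [show 1 - 1 / (n : ℝ) = ((n : ℝ) - 1) / n by field_simp, Real.div_rpow hq.le hp.le,
    Real.mul_rpow hp.le hq.le, Real.sqrt_eq_rpow, div_eq_div_iff (by positivity) (by positivity)]
  have e1 : ((n : ℝ) - 1) ^ (1 / 4 : ℝ) * ((n : ℝ) - 1) ^ (3 / 4 : ℝ) = (n : ℝ) - 1 := by
    rw [← Real.rpow_add hq]; norm_num
  have e2 : (n : ℝ) ^ (1 / 2 : ℝ) * (n : ℝ) ^ (1 / 4 : ℝ) = (n : ℝ) ^ (3 / 4 : ℝ) := by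
    rw [← Real.rpow_add hp]; norm_num
  linear_combination (n : ℝ) ^ (3 / 4 : ℝ) * e1 - ((n : ℝ) - 1) * e2

theorem hajek_factor_mul_inv_sqrt {n : ℕ} (hn : n ≠ 0) (s : ℝ) :
    ((n : ℝ) - 1) * √n / ((n : ℝ) * ((n : ℝ) - 1)) ^ (3 / 4 : ℝ) * ((√n)⁻¹ * s) =
      ((n : ℝ) - 1) * s / ((n : ℝ) * ((n : ℝ) - 1)) ^ (3 / 4 : ℝ) := by
  have : √(n : ℝ) ≠ 0 := by positivity
  field_simp

/-- Chebyshev's inequality. -/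
theorem tendstoInMeasure_zero_of_integral_sq {Ω : Type*} [MeasurableSpace Ω] {P : Measure Ω}
    [IsFiniteMeasure P] {R : ℕ → Ω → ℝ}
    (hR : ∀ n, MemLp (R n) 2 P) (h : Tendsto (fun n => ∫ ω, R n ω ^ 2 ∂P) atTop (nhds 0)) :
    TendstoInMeasure P R atTop (fun _ => 0) := by
  rw [tendstoInMeasure_iff_measureReal_norm]
  intro ε hε
  have hbound (n : ℕ) : P.real {ω | ε ≤ ‖R n ω - 0‖} ≤ (∫ ω, R n ω ^ 2 ∂P) / ε ^ 2 := by
    rw [le_div_iff₀ (by positivity), mul_comm]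
    refine le_trans ?_ (mul_meas_ge_le_integral_of_nonneg (ae_of_all _ fun ω => sq_nonneg (R n ω))
      (hR n).integrable_sq (ε ^ 2))
    gcongr ?_ * ?_
    refine measureReal_mono fun ω hω => ?_
    simp only [Set.mem_ofPred_eq, sub_zero, Real.norm_eq_abs] at hω ⊢
    rw [← sq_abs (R n ω)]
    gcongr
  refine squeeze_zero (fun n => measureReal_nonneg) hbound ?_
  simpa using h.div_const (ε ^ 2)

/-- **Central limit theorem for U-statistics** with a symmetric kernel with values in `[0, 1]`. -/
theorem tendstoInDistribution_uStatistic {f : α → α → ℝ}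
    (hf : Measurable fun q : α × α => f q.1 q.2) (hb : ∀ x y, f x y ∈ Set.Icc (0 : ℝ) 1)
    (hs : ∀ x y, f x y = f y x) {m : ℝ} (hm : m = ∫ x, (∫ y, f x y ∂U) ∂U) :
    TendstoInDistribution
      (fun (n : ℕ) (x : ℕ → α) =>
        (∑ p ∈ orderedPairs (Finset.range n), (f (x p.1) (x p.2) - m)) /
          ((n : ℝ) * ((n : ℝ) - 1)) ^ (3 / 4 : ℝ))
      atTop (id : ℝ → ℝ) (fun _ => Measure.infinitePi (fun _ => U))
      (gaussianReal 0 ((∫ x, (∫ y, f x y ∂U) ^ 2 ∂U) - m ^ 2).toNNReal) := by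
  set Q : Measure (ℕ → α) := Measure.infinitePi (fun _ => U) with hQ
  set h : α → ℝ := fun x => ∫ y, f x y ∂U with hh
  have hhm : Measurable h := (hf.stronglyMeasurable.integral_prod_right (ν := U)).measurable
  have hhb (x : α) : h x ∈ Set.Icc (0 : ℝ) 1 := by
    refine ⟨integral_nonneg fun y => (hb x y).1, ?_⟩
    have := integral_mono_of_nonneg (μ := U) (f := fun y => f x y) (g := fun _ => 1)
      (ae_of_all _ fun y => (hb x y).1) (integrable_const _) (ae_of_all _ fun y => (hb x y).2)
    simpa using this
  have hhi : Integrable h U := integrable_of_mem_Icc 0 1 hhm hhb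
  have hmb : m ∈ Set.Icc (0 : ℝ) 1 := by
    rw [hm]
    refine ⟨integral_nonneg fun y => (hhb y).1, ?_⟩
    have := integral_mono_of_nonneg (μ := U) (f := h) (g := fun _ => 1)
      (ae_of_all _ fun y => (hhb y).1) (integrable_const _) (ae_of_all _ fun y => (hhb y).2)
    simpa using this
  -- The degenerate part of the Hoeffding decomposition: what remains of `f - m` after subtracting
  -- `h x - m` and `h y - m`.
  set g : α → α → ℝ := fun x y => f x y - h x - h y + m with hg
  have hgm : Measurable fun q : α × α => g q.1 q.2 :=
    ((hf.sub (hhm.comp measurable_fst)).sub (hhm.comp measurable_snd)).add_const m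
  have hgC (x y : α) : |g x y| ≤ 2 := by
    have := hb x y; have := hhb x; have := hhb y
    simp only [Set.mem_Icc] at *
    rw [abs_le, hg]; constructor <;> dsimp only <;> linarith
  have hgs (x y : α) : g x y = g y x := by rw [hg]; dsimp only; rw [hs]; ring
  have hg0 (y : α) : ∫ x, g x y ∂U = 0 := by
    have hfy : Measurable fun x => f x y := hf.comp (g := fun q : α × α => f q.1 q.2)
      (f := fun x => (x, y)) (by fun_prop)
    have hfi : Integrable (fun x => f x y) U := integrable_of_mem_Icc 0 1 hfy fun x => hb x y
    have hsy : ∫ x, f x y ∂U = h y := by simp only [hh, hs _ y]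
    rw [hg]
    dsimp only
    rw [integral_add (by fun_prop) (by fun_prop), integral_sub (by fun_prop) (by fun_prop),
      integral_sub hfi hhi, hsy, ← hm]
    simp
  -- the linear part
  have hXind : iIndepFun (fun (k : ℕ) (x : ℕ → α) => h (x k)) Q :=
    iIndepFun_infinitePi (X := fun _ => h) fun _ => hhm
  have hlaw (k : ℕ) : Q.map (fun x => h (x k)) = U.map h := by
    rw [← Measure.infinitePi_map_eval (fun _ : ℕ => U) k,
      Measure.map_map hhm (measurable_pi_apply k)]
    rfl
  have hXm (k : ℕ) : Measurable (fun x : ℕ → α => h (x k)) := hhm.comp (measurable_pi_apply k)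
  have hident (k : ℕ) : IdentDistrib (fun x : ℕ → α => h (x k)) (fun x : ℕ → α => h (x 0)) Q Q :=
    ⟨(hXm k).aemeasurable, (hXm 0).aemeasurable, by rw [hlaw, hlaw]⟩
  have hcomp (φ : ℝ → ℝ) (hφ : Measurable φ) : ∫ x, φ (h (x 0)) ∂Q = ∫ y, φ (h y) ∂U := by
    rw [← integral_map (φ := fun x : ℕ → α => h (x 0)) (hXm 0).aemeasurable
      hφ.aestronglyMeasurable, hlaw, integral_map hhm.aemeasurable hφ.aestronglyMeasurable]
  have hmean : ∫ x, h (x 0) ∂Q = m := by rw [hm]; exact hcomp id measurable_id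
  have hXL : MemLp (fun x : ℕ → α => h (x 0)) 2 Q := by
    refine MemLp.of_bound (hXm 0).aestronglyMeasurable 1 (ae_of_all _ fun x => ?_)
    rw [Real.norm_of_nonneg (hhb _).1]
    exact (hhb _).2
  have hvar : variance (fun x : ℕ → α => h (x 0)) Q = (∫ x, h x ^ 2 ∂U) - m ^ 2 := by
    rw [variance_eq_sub hXL, hmean]
    congr 1
    exact hcomp (fun t => t ^ 2) (by fun_prop)
  have hclt := tendstoInDistribution_inv_sqrt_mul_sum_sub (P := Q)
    (X := fun (k : ℕ) (x : ℕ → α) => h (x k)) (Y := (id : ℝ → ℝ)) HasLaw.id hXL hXind hident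
  rw [hvar, hmean] at hclt
  -- the factor
  have hfac : TendstoInMeasure Q (fun (n : ℕ) (_ : ℕ → α) =>
      ((n : ℝ) - 1) * √n / ((n : ℝ) * ((n : ℝ) - 1)) ^ (3 / 4 : ℝ)) atTop (fun _ => 1) :=
    tendstoInMeasure_of_tendsto_ae (fun n => aestronglyMeasurable_const)
      (ae_of_all _ fun _ => tendsto_hajek_factor)
  have hlin := hclt.continuous_comp_prodMk_of_tendstoInMeasure_const
    (g := fun p : ℝ × ℝ => p.2 * p.1) (by fun_prop) hfac (fun n => aemeasurable_const)
  -- the degenerate part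
  set R : ℕ → (ℕ → α) → ℝ := fun n x =>
    (∑ p ∈ orderedPairs (Finset.range n), g (x p.1) (x p.2)) /
      ((n : ℝ) * ((n : ℝ) - 1)) ^ (3 / 4 : ℝ) with hR
  have hgp (p : ℕ × ℕ) : Measurable fun x : ℕ → α => g (x p.1) (x p.2) :=
    hgm.comp (g := fun q : α × α => g q.1 q.2) (f := fun x : ℕ → α => (x p.1, x p.2)) (by fun_prop)
  have hRm (n : ℕ) : Measurable (R n) :=
    (Finset.measurable_fun_sum _ fun p _ => hgp p).div_const _
  have hRL (n : ℕ) : MemLp (R n) 2 Q := by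
    have h1 (p : ℕ × ℕ) : MemLp (fun x : ℕ → α => g (x p.1) (x p.2)) 2 Q :=
      MemLp.of_bound (hgp p).aestronglyMeasurable 2 (ae_of_all _ fun x => hgC _ _)
    have h2 : MemLp (fun x : ℕ → α => ∑ p ∈ orderedPairs (Finset.range n), g (x p.1) (x p.2)) 2 Q :=
      memLp_finsetSum (f := fun (p : ℕ × ℕ) (x : ℕ → α) => g (x p.1) (x p.2)) _ fun p _ => h1 p
    have h3 := h2.mul_const (((n : ℝ) * ((n : ℝ) - 1)) ^ (3 / 4 : ℝ))⁻¹
    simp only [← div_eq_mul_inv] at h3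
    exact h3
  -- There are `n (n - 1) / 2` pairs, each contributing at most `2²`, and the squared normalization
  -- is `(n (n - 1))^(3/2)`. For `n ≤ 1` both sides are `0` by the conventions for division by zero
  -- and powers of zero.
  have hRsq (n : ℕ) : ∫ x, R n x ^ 2 ∂Q ≤ 2 * ((n : ℝ) * ((n : ℝ) - 1)) ^ (-(1 / 2) : ℝ) := by
    have h1 := integral_sq_sum_orderedPairs_le hgm hgC hgs hg0 (Finset.range n)
    rw [card_orderedPairs, Finset.card_range] at h1
    simp only [hR, div_pow]
    rw [integral_div]
    have hN : 0 ≤ (n : ℝ) * ((n : ℝ) - 1) := by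
      rcases Nat.eq_zero_or_pos n with rfl | hn
      · simp
      · have : (1 : ℝ) ≤ n := by exact_mod_cast hn
        exact mul_nonneg (by positivity) (by linarith)
    rcases hN.eq_or_lt with h0 | hpos
    · rw [← h0, Real.zero_rpow (by norm_num), Real.zero_rpow (by norm_num)]
      simp
    · rw [div_le_iff₀ (by positivity)]
      refine h1.trans (le_of_eq ?_)
      generalize (n : ℝ) * ((n : ℝ) - 1) = N at *
      have e : N ^ (-(1 / 2) : ℝ) * (N ^ (3 / 4 : ℝ)) ^ 2 = N := by
        rw [← Real.rpow_natCast (N ^ (3 / 4 : ℝ)), ← Real.rpow_mul hN, ← Real.rpow_add hpos]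
        norm_num
      rw [mul_assoc, e]
      ring
  have hRlim : Tendsto (fun n => ∫ x, R n x ^ 2 ∂Q) atTop (nhds 0) := by
    refine squeeze_zero (fun n => integral_nonneg fun x => sq_nonneg _) hRsq ?_
    have h1 : Tendsto (fun n : ℕ => (n : ℝ) * ((n : ℝ) - 1)) atTop atTop :=
      tendsto_natCast_atTop_atTop.atTop_mul_atTop₀
        (tendsto_atTop_add_const_right _ (-1) tendsto_natCast_atTop_atTop)
    simpa using ((tendsto_rpow_neg_atTop (by norm_num : (0 : ℝ) < 1 / 2)).comp h1).const_mul 2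
  -- Slutsky: the linear part converges in distribution and the remainder vanishes in probability.
  have hfinal := hlin.add_of_tendstoInMeasure_const
    (tendstoInMeasure_zero_of_integral_sq hRL hRlim) (fun n => (hRm n).aemeasurable)
  refine hfinal.congr (fun n => ae_of_all _ fun x => ?_) (ae_of_all _ fun t => by simp)
  rcases Nat.eq_zero_or_pos n with rfl | hn
  · simp [hR]
  simp only [Pi.add_apply, hR]
  rw [hajek_factor_mul_inv_sqrt hn.ne', ← add_div]
  congr 1
  have h1 := sum_orderedPairs_add (Finset.range n) (fun i => h (x i) - m)
  rw [Finset.card_range, Finset.sum_sub_distrib, Finset.sum_const, Finset.card_range,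
    nsmul_eq_mul] at h1
  rw [← h1, ← Finset.sum_add_distrib]
  refine Finset.sum_congr rfl fun p _ => ?_
  rw [hg]
  ring

end UStatistic

/-! ### Poisson mixtures -/

theorem tendsto_poissonMeasure_real_singleton (k : ℕ) :
    Tendsto (fun m : NNReal => (poissonMeasure m).real {k}) atTop (nhds 0) := by
  simp only [poissonMeasure_real_singleton]
  have h := ((Real.tendsto_pow_mul_exp_neg_atTop_nhds_zero k).comp
    (NNReal.tendsto_coe_atTop.2 tendsto_id)).div_const (k.factorial : ℝ)
  rw [zero_div] at h
  refine h.congr fun m => ?_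
  simp [mul_comm]

/-- Beyond some `M` the values of `G` are within `ε / 2` of `L`. On `{0, …, M}` the error is at most
`C + |L|`, and the Poisson mass of this finite set vanishes as the mean grows. -/
theorem tendsto_integral_poissonMeasure {G : ℕ → ℝ} {L C : ℝ} (hG : ∀ n, |G n| ≤ C)
    (hlim : Tendsto G atTop (nhds L)) :
    Tendsto (fun m : NNReal => ∫ n, G n ∂poissonMeasure m) atTop (nhds L) := by
  rw [Metric.tendsto_atTop'] at hlim
  rw [Metric.tendsto_nhds]
  intro ε hε
  obtain ⟨M, hM⟩ := hlim (ε / 2) (by positivity)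
  have hC : 0 ≤ C := (abs_nonneg _).trans (hG 0)
  have hsmall : Tendsto (fun m : NNReal => (C + |L|) * ∑ k ∈ Finset.range (M + 1),
      (poissonMeasure m).real {k}) atTop (nhds 0) := by
    simpa using (tendsto_finsetSum (Finset.range (M + 1))
      fun k _ => tendsto_poissonMeasure_real_singleton k).const_mul (C + |L|)
  filter_upwards [hsmall.eventually (gt_mem_nhds (half_pos hε))] with m hm
  have hGi : Integrable G (poissonMeasure m) :=
    Integrable.of_bound .of_discrete C (ae_of_all _ hG)
  have hind : Integrable (fun n => ε / 2 + (C + |L|) *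
      (Finset.range (M + 1) : Set ℕ).indicator 1 n) (poissonMeasure m) :=
    (integrable_const _).add (((integrable_const (1 : ℝ)).indicator
      (Finset.measurableSet _)).const_mul _)
  have hset : ∫ n, (Finset.range (M + 1) : Set ℕ).indicator (1 : ℕ → ℝ) n ∂poissonMeasure m =
      ∑ k ∈ Finset.range (M + 1), (poissonMeasure m).real {k} := by
    rw [integral_indicator_one (Finset.measurableSet _), sum_measureReal_singleton]
  rw [dist_eq_norm, Real.norm_eq_abs]
  calc |∫ n, G n ∂poissonMeasure m - L| = |∫ n, (G n - L) ∂poissonMeasure m| := by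
        rw [integral_sub hGi (integrable_const _)]; simp
    _ ≤ ∫ n, |G n - L| ∂poissonMeasure m := abs_integral_le_integral_abs
    _ ≤ ∫ n, (ε / 2 + (C + |L|) * (Finset.range (M + 1) : Set ℕ).indicator 1 n)
          ∂poissonMeasure m := by
        refine integral_mono (hGi.sub (integrable_const _)).abs hind fun n => ?_
        dsimp only
        by_cases hn : n ∈ Finset.range (M + 1)
        · rw [Set.indicator_of_mem (by exact_mod_cast hn), Pi.one_apply, mul_one]
          have := abs_sub (G n) L
          linarith [hG n]
        · rw [Set.indicator_of_notMem (by exact_mod_cast hn), mul_zero, add_zero]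
          have := hM n (by simpa using hn)
          rw [dist_eq_norm, Real.norm_eq_abs] at this
          exact this.le
    _ = ε / 2 + (C + |L|) * ∑ k ∈ Finset.range (M + 1), (poissonMeasure m).real {k} := by
        rw [integral_add (integrable_const _), integral_const_mul, hset]
        · simp
        · exact ((integrable_const (1 : ℝ)).indicator (Finset.measurableSet _)).const_mul _
    _ < ε := by linarith

/-! ### The limit theorem for mixed binomial samples -/

theorem measurable_normalizedSum (r a b : ℝ) (I : Finset ℕ) :
    Measurable (normalizedSum r a b I) := by
  refine Measurable.div_const (Finset.measurable_fun_sum _ fun p _ => ?_) _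
  have h := (measurable_crossKernel r a b).comp
    ((measurable_pi_apply (X := fun _ : ℕ => ℝ × ℝ) p.1).prodMk (measurable_pi_apply p.2))
  exact Measurable.sub_const h _

theorem normalizedSum_dilateLine {r : ℝ} (hr : 0 < r) (a b : ℝ) (I : Finset ℕ)
    (x : ℕ → ℝ × ℝ) :
    normalizedSum r a b I (fun i => dilateLine r (x i)) = normalizedSum 1 a b I x := by
  unfold normalizedSum
  simp only [crossKernel_dilateLine hr]

/-- The joint law of a Poisson number with mean `2 λ r` and an independent sequence of independent
uniformly distributed lines hitting the disc of radius `r`. -/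
noncomputable def mixedSample (lam r : ℝ) : Measure (ℕ × (ℕ → ℝ × ℝ)) :=
  (poissonMeasure (2 * lam * r).toNNReal).prod (Measure.infinitePi fun _ => uniformLine r)

theorem isProbabilityMeasure_mixedSample (lam : ℝ) {r : ℝ} (hr : 0 < r) :
    IsProbabilityMeasure (mixedSample lam r) := by
  have := isProbabilityMeasure_uniformLine hr
  unfold mixedSample
  infer_instance

/-- The normalized sum of the first `n` lines of a sequence. -/
noncomputable def sampleSum (r a b : ℝ) (w : ℕ × (ℕ → ℝ × ℝ)) : ℝ :=
  normalizedSum r a b (Finset.range w.1) w.2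

theorem measurable_sampleSum (r a b : ℝ) : Measurable (sampleSum r a b) :=
  measurable_from_prod_countable_right fun n => measurable_normalizedSum r a b (Finset.range n)

theorem integral_comp_normalizedSum {r : ℝ} (hr : 0 < r) (a b : ℝ) (I : Finset ℕ) {φ : ℝ → ℝ}
    (hφ : Measurable φ) :
    ∫ x, φ (normalizedSum r a b I x) ∂Measure.infinitePi (fun _ : ℕ => uniformLine r) =
      ∫ x, φ (normalizedSum 1 a b I x) ∂Measure.infinitePi (fun _ : ℕ => uniformLine 1) := by
  have := isProbabilityMeasure_uniformLine one_pos
  have h := Measure.infinitePi_map_pi (fun _ : ℕ => uniformLine 1)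
    (f := fun _ => dilateLine r) (fun _ => measurable_dilateLine r)
  simp only [map_dilateLine_uniformLine hr] at h
  rw [← h, integral_map]
  · simp only [normalizedSum_dilateLine hr]
  · exact (measurable_pi_lambda _ fun i =>
      (measurable_dilateLine r).comp (measurable_pi_apply i)).aemeasurable
  · exact (hφ.comp (measurable_normalizedSum r a b I)).aestronglyMeasurable

theorem tendstoInDistribution_normalizedSum_range (a b : ℝ) :
    letI := isProbabilityMeasure_uniformLine one_pos
    TendstoInDistribution (fun n : ℕ => normalizedSum 1 a b (Finset.range n)) atTop (id : ℝ → ℝ)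
      (fun _ => Measure.infinitePi (fun _ : ℕ => uniformLine 1))
      (gaussianReal 0 (sigmaB a b - muB a b ^ 2).toNNReal) := by
  have := isProbabilityMeasure_uniformLine one_pos
  have h := tendstoInDistribution_uStatistic (U := uniformLine 1) (measurable_crossKernel 1 a b)
    (crossKernel_mem_Icc 1 a b) (crossKernel_comm 1 a b) (muB_eq_integral a b)
  rw [← sigmaB_eq_integral] at h
  refine h.congr (fun n => ae_of_all _ fun x => ?_) (ae_of_all _ fun t => rfl)
  simp only [normalizedSum, Finset.card_range]

/-- Conditioning on the number of lines leaves, by dilation, a function `G n` free of `r`. The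
radius then enters only through the Poisson mean, which tends to infinity. -/
theorem tendsto_integral_sampleSum {lam : ℝ} (hlam : 0 < lam) (a b : ℝ)
    (φ : BoundedContinuousFunction ℝ ℝ) :
    Tendsto (fun r : Set.Ioi (0 : ℝ) => ∫ w, φ (sampleSum r a b w) ∂mixedSample lam r) atTop
      (nhds (∫ t, φ t ∂gaussianReal 0 (sigmaB a b - muB a b ^ 2).toNNReal)) := by
  have := isProbabilityMeasure_uniformLine one_pos
  have hφm : Measurable φ := φ.continuous.measurable
  set G : ℕ → ℝ := fun n => ∫ x, φ (normalizedSum 1 a b (Finset.range n) x)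
    ∂Measure.infinitePi (fun _ : ℕ => uniformLine 1) with hG
  have hGb (n : ℕ) : |G n| ≤ ‖φ‖ := by
    rw [← Real.norm_eq_abs]
    refine (norm_integral_le_of_norm_le_const (ae_of_all _ fun x => φ.norm_coe_le_norm _)).trans ?_
    simp
  have hGlim : Tendsto G atTop
      (nhds (∫ t, φ t ∂gaussianReal 0 (sigmaB a b - muB a b ^ 2).toNNReal)) := by
    have h2 : Tendsto (fun n : ℕ => ∫ t, φ t ∂(Measure.infinitePi
        (fun _ : ℕ => uniformLine 1)).map (normalizedSum 1 a b (Finset.range n))) atTop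
        (nhds (∫ t, φ t ∂(gaussianReal 0 (sigmaB a b - muB a b ^ 2).toNNReal).map id)) :=
      ProbabilityMeasure.tendsto_iff_forall_integral_tendsto.1
        (tendstoInDistribution_normalizedSum_range a b).tendsto φ
    rw [Measure.map_id] at h2
    refine h2.congr fun n => ?_
    exact integral_map (measurable_normalizedSum _ _ _ _).aemeasurable hφm.aestronglyMeasurable
  have hmean : Tendsto (fun r : Set.Ioi (0 : ℝ) => (2 * lam * r).toNNReal) atTop atTop := by
    have h1 : Tendsto (fun r : ℝ => 2 * lam * r) atTop atTop :=
      tendsto_id.const_mul_atTop (by positivity)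
    exact tendsto_comp_val_Ioi_atTop.2 (tendsto_real_toNNReal_atTop.comp h1)
  refine ((tendsto_integral_poissonMeasure hGb hGlim).comp hmean).congr fun r => ?_
  have hr : (0 : ℝ) < r := r.2
  have := isProbabilityMeasure_uniformLine hr
  have hint : Integrable (fun w => φ (sampleSum r a b w)) (mixedSample lam r) := by
    have := isProbabilityMeasure_mixedSample lam hr
    exact Integrable.of_bound (hφm.comp (measurable_sampleSum r a b)).aestronglyMeasurable ‖φ‖
      (ae_of_all _ fun x => φ.norm_coe_le_norm _)
  unfold mixedSample at hint ⊢
  rw [integral_prod _ hint]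
  simp only [sampleSum, integral_comp_normalizedSum hr a b _ hφm, Function.comp_apply, hG]

/-- Convergence in distribution involves each law separately, so nothing is needed about the joint
behaviour for different radii. -/
theorem tendstoInDistribution_of_map_eq_sampleSum {Ω : Type*} [MeasurableSpace Ω]
    {P : Measure Ω} [IsProbabilityMeasure P] {lam : ℝ} (hlam : 0 < lam) {a b : ℝ}
    {Z : Set.Ioi (0 : ℝ) → Ω → ℝ} (hZ : ∀ r, AEMeasurable (Z r) P)
    (hlaw : ∀ r : Set.Ioi (0 : ℝ), P.map (Z r) = (mixedSample lam r).map (sampleSum r a b)) :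
    TendstoInDistribution Z atTop (id : ℝ → ℝ) (fun _ => P)
      (gaussianReal 0 (sigmaB a b - muB a b ^ 2).toNNReal) where
  forall_aemeasurable := hZ
  tendsto := by
    refine ProbabilityMeasure.tendsto_iff_forall_integral_tendsto.2 fun φ => ?_
    have h : Tendsto (fun r => ∫ t, φ t ∂P.map (Z r)) atTop
        (nhds (∫ t, φ t ∂(gaussianReal 0 (sigmaB a b - muB a b ^ 2).toNNReal).map id)) := by
      rw [Measure.map_id]
      refine (tendsto_integral_sampleSum hlam a b φ).congr fun r => ?_
      rw [hlaw, integral_map (measurable_sampleSum r a b).aemeasurable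
        φ.continuous.measurable.aestronglyMeasurable]
    exact h

theorem IsPoissonLineSample.map_eq_mixedSample {Ω : Type*} [MeasurableSpace Ω] {P : Measure Ω}
    [IsProbabilityMeasure P] {lam r : ℝ} (hr : 0 < r) {N : Ω → ℕ} {X : ℕ → Ω → ℝ × ℝ}
    (h : IsPoissonLineSample P lam r N X) :
    P.map (fun ω => (N ω, fun i => X i ω)) = mixedSample lam r := by
  have := isProbabilityMeasure_uniformLine hr
  have hX : Measurable (fun ω i => X i ω) := measurable_pi_lambda _ h.measurable_X
  rw [h.indep_N_X.map_prod_eq_prod_map_map h.measurable_N.aemeasurable hX.aemeasurable,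
    h.law_N.map_eq, (h.indep_X.hasLaw_infinitePi h.law_X hX.aemeasurable).map_eq]
  rfl

/-! ### Laws of random finite measures -/

theorem exists_enum_of_finite_range {E : Type*} {g : E → ℝ} (hfin : (Set.range g).Finite) :
    ∃ (n : ℕ) (v : Fin n → ℝ), Function.Injective v ∧ ∀ x, ∃ k, g x = v k := by
  refine ⟨_, fun k => (hfin.toFinset.equivFin.symm k : ℝ), ?_, fun x => ?_⟩
  · exact Subtype.val_injective.comp (Equiv.injective _)
  · exact ⟨hfin.toFinset.equivFin ⟨g x, by simp⟩, by simp⟩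

theorem finite_range_sum_indicator {E ι : Type*} [Fintype ι] (c : ι → ℝ) (B : ι → Set E) :
    (Set.range fun x => ∑ i, c i * (B i).indicator (1 : E → ℝ) x).Finite := by
  classical
  refine (Set.finite_range fun p : ι → Prop => ∑ i, c i * if p i then 1 else 0).subset ?_
  rintro _ ⟨x, rfl⟩
  exact ⟨fun i => x ∈ B i, by simp [Set.indicator_apply]⟩

section RandomMeasure

variable {E : Type*} [MeasurableSpace E]

theorem integral_comp_eq_sum_of_finite_range {F : Type*} [NormedAddCommGroup F] [NormedSpace ℝ F]
    [CompleteSpace F] {μ : Measure E} [IsFiniteMeasure μ] {g : E → ℝ} (hg : Measurable g) {n : ℕ}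
    {v : Fin n → ℝ} (hv : Function.Injective v) (hgv : ∀ x, ∃ k, g x = v k) (φ : ℝ → F) :
    ∫ x, φ (g x) ∂μ = ∑ k, μ.real (g ⁻¹' {v k}) • φ (v k) := by
  have hm (k : Fin n) : MeasurableSet (g ⁻¹' {v k}) := hg (measurableSet_singleton _)
  have h (x : E) : φ (g x) = ∑ k, (g ⁻¹' {v k}).indicator (fun _ => φ (v k)) x := by
    obtain ⟨k, hk⟩ := hgv x
    rw [Finset.sum_eq_single k]
    · rw [Set.indicator_of_mem (by simpa using hk), hk]
    · intro l _ hlk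
      refine Set.indicator_of_notMem (fun hx => hlk (hv ?_)) _
      rw [← hk]
      exact (Set.mem_preimage.1 hx).symm
    · simp
  simp only [h]
  rw [integral_finsetSum _ fun k _ => (integrable_const _).indicator (hm k)]
  exact Finset.sum_congr rfl fun k _ => integral_indicator_const _ (hm k)

theorem integral_sum_indicator {ι : Type*} [Fintype ι] (c : ι → ℝ) {B : ι → Set E}
    (hB : ∀ i, MeasurableSet (B i)) (μ : Measure E) [IsFiniteMeasure μ] :
    ∫ x, (∑ i, c i * (B i).indicator (1 : E → ℝ) x) ∂μ = ∑ i, c i * μ.real (B i) := by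
  have hint (i : ι) : Integrable ((B i).indicator (1 : E → ℝ)) μ :=
    (integrable_const (1 : ℝ)).indicator (hB i)
  rw [integral_finsetSum _ fun i _ => (hint i).const_mul _]
  refine Finset.sum_congr rfl fun i _ => ?_
  rw [integral_const_mul, integral_indicator_one (hB i)]

theorem measurable_finiteMeasure_real {B : Set E} (hB : MeasurableSet B) :
    Measurable fun μ : FiniteMeasure E => (μ : Measure E).real B :=
  ((Measure.measurable_coe hB).comp measurable_subtype_coe).ennreal_toReal

/-- The σ-algebra on measures is generated by the evaluations. For finite measures these can be
taken real-valued, so a random measure becomes a real process indexed by measurable sets. -/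
theorem exists_measurableSet_eq_preimage_eval {S : Set (FiniteMeasure E)} (hS : MeasurableSet S) :
    ∃ S' : Set ({B : Set E // MeasurableSet B} → ℝ), MeasurableSet S' ∧
      (fun (μ : FiniteMeasure E) (B : {B : Set E // MeasurableSet B}) =>
        (μ : Measure E).real B) ⁻¹' S' = S := by
  obtain ⟨S0, hS0, rfl⟩ := hS
  have hle : (Measure.instMeasurableSpace : MeasurableSpace (Measure E)) ≤
      MeasurableSpace.comap (fun (μ : Measure E) (B : {B : Set E // MeasurableSet B}) => μ B)
        MeasurableSpace.pi := by
    refine iSup₂_le fun B hB => ?_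
    rw [← measurable_iff_comap_le]
    exact (measurable_pi_apply (X := fun _ : {B : Set E // MeasurableSet B} => ENNReal)
      ⟨B, hB⟩).comp (comap_measurable _)
  obtain ⟨S1, hS1, rfl⟩ := hle S0 hS0
  refine ⟨(fun (y : {B : Set E // MeasurableSet B} → ℝ) B => ENNReal.ofReal (y B)) ⁻¹' S1,
    (measurable_pi_lambda _ fun B => (measurable_pi_apply B).ennreal_ofReal) hS1, ?_⟩
  ext μ
  have h : (fun B : {B : Set E // MeasurableSet B} => ENNReal.ofReal ((μ : Measure E).real B)) =
      fun B => (μ : Measure E) B.1 := funext fun B => ofReal_measureReal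
  simp only [Set.mem_preimage, h]
  rfl

variable {Ω Ω' : Type*} [MeasurableSpace Ω] [MeasurableSpace Ω'] {P : Measure Ω} {P' : Measure Ω'}
  [IsProbabilityMeasure P] [IsProbabilityMeasure P']

/-- The law of a random finite measure is determined by its characteristic functional. -/
theorem map_finiteMeasure_eq_of_charFunctional {η : Ω → FiniteMeasure E}
    {η' : Ω' → FiniteMeasure E} (hη : Measurable η) (hη' : Measurable η')
    (h : ∀ g : E → ℝ, Measurable g → (Set.range g).Finite →
      ∫ ω, Complex.exp ((∫ x, g x ∂(η ω : Measure E) : ℝ) * Complex.I) ∂P =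
        ∫ ω, Complex.exp ((∫ x, g x ∂(η' ω : Measure E) : ℝ) * Complex.I) ∂P') :
    P.map η = P'.map η' := by
  set T := {B : Set E // MeasurableSet B} with hT
  set X : T → Ω → ℝ := fun B ω => (η ω : Measure E).real B with hX
  set X' : T → Ω' → ℝ := fun B ω => (η' ω : Measure E).real B with hX'
  have hXm (B : T) : Measurable (X B) := (measurable_finiteMeasure_real B.2).comp hη
  have hXm' (B : T) : Measurable (X' B) := (measurable_finiteMeasure_real B.2).comp hη'
  have hfin (J : Finset T) : P.map (fun ω => J.restrict (X · ω)) =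
      P'.map (fun ω => J.restrict (X' · ω)) := by
    classical
    have m1 : Measurable (fun ω => J.restrict (X · ω)) :=
      measurable_pi_lambda _ fun B => hXm B
    have m2 : Measurable (fun ω => J.restrict (X' · ω)) :=
      measurable_pi_lambda _ fun B => hXm' B
    have := Measure.isProbabilityMeasure_map (μ := P) m1.aemeasurable
    have := Measure.isProbabilityMeasure_map (μ := P') m2.aemeasurable
    refine Measure.ext_of_charFunDual (funext fun L => ?_)
    rw [charFunDual_apply, charFunDual_apply, integral_map m1.aemeasurable (by fun_prop),
      integral_map m2.aemeasurable (by fun_prop)]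
    -- A linear functional of the vector of evaluations is the integral of the step function `∑ c_B
    -- 1_B`, so the hypothesis gives the characteristic function of each finite-dimensional law.
    set c : J → ℝ := fun B => L (fun B' => if B = B' then 1 else 0) with hc
    have hL (y : J → ℝ) : L y = ∑ B, c B * y B := by
      have := L.toLinearMap.pi_apply_eq_sum_univ y
      simpa [mul_comm, hc] using this
    have hgm : Measurable fun x => ∑ B : J, c B * (B.1.1).indicator (1 : E → ℝ) x :=
      Finset.measurable_fun_sum _ fun B _ => (measurable_one.indicator B.1.2).const_mul _
    have key := h _ hgm (finite_range_sum_indicator c fun B : J => B.1.1)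
    simp only [integral_sum_indicator c (fun B : J => B.1.2)] at key
    simp only [hL]
    exact key
  -- The finite-dimensional laws determine the law on the full product, by uniqueness of projective
  -- limits.
  have hlim := isProjectiveLimit_map (P := P) (X := X) (measurable_pi_lambda _ hXm).aemeasurable
  have hlim' := isProjectiveLimit_map (P := P') (X := X')
    (measurable_pi_lambda _ hXm').aemeasurable
  simp only [hfin] at hlim
  have hmap := hlim.unique hlim'
  refine Measure.ext fun S hS => ?_
  obtain ⟨S', hS', rfl⟩ := exists_measurableSet_eq_preimage_eval hS
  rw [Measure.map_apply hη hS, Measure.map_apply hη' hS]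
  have := congrArg (fun ν => ν S') hmap
  rw [Measure.map_apply (measurable_pi_lambda _ hXm) hS',
    Measure.map_apply (measurable_pi_lambda _ hXm') hS'] at this
  exact this

/-- The counting measure of the points `x i`, `i ∈ I`. -/
noncomputable def diracSum (I : Finset ℕ) (x : ℕ → E) : FiniteMeasure E :=
  ⟨∑ i ∈ I, Measure.dirac (x i), inferInstance⟩

theorem coe_diracSum (I : Finset ℕ) (x : ℕ → E) :
    (diracSum I x : Measure E) = ∑ i ∈ I, Measure.dirac (x i) := rfl

theorem measurable_diracSum (I : Finset ℕ) : Measurable (diracSum I : (ℕ → E) → _) := by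
  refine Measurable.subtype_mk (Measure.measurable_of_measurable_coe _ fun B hB => ?_)
  simp only [Measure.finsetSum_apply]
  exact Finset.measurable_fun_sum _ fun i _ =>
    (Measure.measurable_coe hB).comp (Measure.measurable_dirac.comp (measurable_pi_apply i))

theorem lintegral_diracSum (I : Finset ℕ) (x : ℕ → E) {F : E → ENNReal} (hF : Measurable F) :
    ∫⁻ y, F y ∂(diracSum I x : Measure E) = ∑ i ∈ I, F (x i) := by
  rw [coe_diracSum, lintegral_finsetSum_measure]
  exact Finset.sum_congr rfl fun i _ => lintegral_dirac' _ hF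

theorem integral_diracSum (I : Finset ℕ) (x : ℕ → E) {g : E → ℝ} (hg : Measurable g) :
    ∫ y, g y ∂(diracSum I x : Measure E) = ∑ i ∈ I, g (x i) := by
  rw [coe_diracSum, integral_finsetSum_measure fun i _ =>
    integrable_dirac' hg.stronglyMeasurable (by simp)]
  exact Finset.sum_congr rfl fun i _ => integral_dirac' _ _ hg.stronglyMeasurable

end RandomMeasure

/-! ### Characteristic functionals of Poisson processes -/

theorem integral_pow_poissonMeasure (c : NNReal) (z : ℂ) :
    ∫ n, z ^ n ∂poissonMeasure c = Complex.exp (c * (z - 1)) := by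
  rw [integral_poissonMeasure]
  calc ∑' n : ℕ, (Real.exp (-c) * c ^ n / n.factorial) • z ^ n
      = ∑' n : ℕ, (Real.exp (-c) : ℂ) * ((c * z) ^ n / n.factorial) := by
        congr with n
        rw [Complex.real_smul]
        push_cast
        rw [mul_pow]
        ring
    _ = (Real.exp (-c) : ℂ) * Complex.exp (c * z) := by
        rw [tsum_mul_left, (NormedSpace.expSeries_div_hasSum_exp ((c : ℂ) * z)).tsum_eq,
          Complex.exp_eq_exp_ℂ]
    _ = Complex.exp (c * (z - 1)) := by
        rw [Complex.ofReal_exp, ← Complex.exp_add]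
        push_cast
        ring_nf

theorem integral_exp_sum_range_infinitePi {E : Type*} [MeasurableSpace E] (U : Measure E)
    [IsProbabilityMeasure U] {g : E → ℝ} (hg : Measurable g) (n : ℕ) :
    ∫ x : ℕ → E, Complex.exp ((∑ i ∈ Finset.range n, g (x i) : ℝ) * Complex.I)
        ∂Measure.infinitePi (fun _ => U) =
      (∫ x, Complex.exp (g x * Complex.I) ∂U) ^ n := by
  have hind : iIndepFun (fun (k : ℕ) (x : ℕ → E) => x k) (Measure.infinitePi fun _ => U) :=
    iIndepFun_infinitePi (X := fun _ x => x) (fun _ => measurable_id)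
  have hind' := hind.precomp (Fin.val_injective (n := n))
  have hψ : Measurable fun y => Complex.exp (g y * Complex.I) := by fun_prop
  have h := hind'.integral_fun_prod_comp (f := fun _ y => Complex.exp (g y * Complex.I))
    (fun i => (measurable_pi_apply _).aemeasurable) (fun i => hψ.aestronglyMeasurable)
  have hone (k : ℕ) : ∫ x : ℕ → E, Complex.exp (g (x k) * Complex.I)
      ∂Measure.infinitePi (fun _ => U) = ∫ x, Complex.exp (g x * Complex.I) ∂U := by
    conv_rhs => rw [← Measure.infinitePi_map_eval (fun _ : ℕ => U) k]
    rw [integral_map (measurable_pi_apply k).aemeasurable hψ.aestronglyMeasurable]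
  simp only [hone, Finset.prod_const, Finset.card_univ, Fintype.card_fin] at h
  rw [← h]
  congr with x
  rw [Complex.ofReal_sum, Finset.sum_mul, Complex.exp_sum, Finset.prod_range]

/-- Given `n` points the characteristic functional is an `n`-th power by independence; averaging
over `n` is the Poisson generating function. -/
theorem integral_exp_diracSum_mixed {E : Type*} [MeasurableSpace E] (U : Measure E)
    [IsProbabilityMeasure U] (c : NNReal) {g : E → ℝ} (hg : Measurable g) :
    ∫ w : ℕ × (ℕ → E), Complex.exp
        ((∫ y, g y ∂(diracSum (Finset.range w.1) w.2 : Measure E) : ℝ) * Complex.I)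
        ∂((poissonMeasure c).prod (Measure.infinitePi fun _ => U)) =
      Complex.exp (c * ((∫ x, Complex.exp (g x * Complex.I) ∂U) - 1)) := by
  simp only [integral_diracSum _ _ hg]
  have hm : Measurable fun w : ℕ × (ℕ → E) =>
      Complex.exp ((∑ i ∈ Finset.range w.1, g (w.2 i) : ℝ) * Complex.I) := by
    refine measurable_from_prod_countable_right fun n => ?_
    have : Measurable fun x : ℕ → E => ∑ i ∈ Finset.range n, g (x i) :=
      Finset.measurable_fun_sum _ fun i _ => hg.comp (measurable_pi_apply i)
    exact Complex.measurable_exp.comp ((Complex.measurable_ofReal.comp this).mul_const _)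
  have hint : Integrable (fun w : ℕ × (ℕ → E) =>
      Complex.exp ((∑ i ∈ Finset.range w.1, g (w.2 i) : ℝ) * Complex.I))
      ((poissonMeasure c).prod (Measure.infinitePi fun _ => U)) :=
    Integrable.of_bound hm.aestronglyMeasurable 1
      (ae_of_all _ fun w => (Complex.norm_exp_ofReal_mul_I _).le)
  rw [integral_prod _ hint]
  simp only [integral_exp_sum_range_infinitePi U hg, integral_pow_poissonMeasure]

namespace IsPoissonLineProcess

variable {Ω : Type*} [MeasurableSpace Ω] {P : Measure Ω} {lam : ℝ} {ξ : ℕ → Ω → ℝ × ℝ}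

theorem measurable_count (h : IsPoissonLineProcess P lam ξ) {B : Set (ℝ × ℝ)}
    (hB : MeasurableSet B) : Measurable fun ω => pointMeasure (fun i => ξ i ω) B := by
  simp only [pointMeasure, Measure.sum_apply _ hB]
  exact Measurable.tsum fun i =>
    (Measure.measurable_coe hB).comp (Measure.measurable_dirac.comp (h.measurable i))

theorem integral_exp_count [IsProbabilityMeasure P] (h : IsPoissonLineProcess P lam ξ) {B : Set (ℝ × ℝ)}
    (hB : MeasurableSet B) (hfin : lineIntensity lam B ≠ ⊤) (v : ℝ) :
    ∫ ω, Complex.exp (((pointMeasure (fun i => ξ i ω) B).toReal * v : ℝ) * Complex.I) ∂P =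
      Complex.exp ((lineIntensity lam B).toReal * (Complex.exp (v * Complex.I) - 1)) := by
  have hm : Measurable fun t : ENNReal => Complex.exp ((t.toReal * v : ℝ) * Complex.I) := by
    fun_prop
  have hcomp := (h.law_count B hB hfin).integral_comp
    (f := fun t : ENNReal => Complex.exp ((t.toReal * v : ℝ) * Complex.I)) hm.aestronglyMeasurable
  simp only [Function.comp_def] at hcomp
  rw [hcomp, integral_map .of_discrete hm.aestronglyMeasurable,
    show (((lineIntensity lam B).toReal : ℝ) : ℂ) = ((lineIntensity lam B).toNNReal : ℂ) from rfl,
    ← integral_pow_poissonMeasure]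
  congr with n
  rw [← Complex.exp_nat_mul]
  simp [mul_assoc]

theorem lineIntensity_inter_lineWindow {lam r : ℝ} (hlam : 0 < lam) (hr : 0 < r)
    {B : Set (ℝ × ℝ)} (hB : MeasurableSet B) :
    lineIntensity lam (B ∩ lineWindow r) = ENNReal.ofReal (2 * lam * r) * uniformLine r B := by
  rw [← Measure.restrict_apply hB, lineIntensity_restrict_lineWindow hlam hr,
    Measure.smul_apply, smul_eq_mul]

/-- The level sets of `g` within the window are disjoint, so their counts are independent Poisson
variables. The product of their characteristic functions is the exponential of a sum that
reassembles to an integral over `uniformLine r`. -/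
theorem integral_exp_pointMeasure [IsProbabilityMeasure P] (h : IsPoissonLineProcess P lam ξ) (hlam : 0 < lam) {r : ℝ}
    (hr : 0 < r) {η : Ω → FiniteMeasure (ℝ × ℝ)}
    (hη : ∀ᵐ ω ∂P, (η ω : Measure (ℝ × ℝ)) =
      (pointMeasure fun i => ξ i ω).restrict (lineWindow r))
    {g : ℝ × ℝ → ℝ} (hg : Measurable g) (hfin : (Set.range g).Finite) :
    ∫ ω, Complex.exp ((∫ x, g x ∂(η ω : Measure (ℝ × ℝ)) : ℝ) * Complex.I) ∂P =
      Complex.exp ((2 * lam * r).toNNReal *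
        ((∫ x, Complex.exp (g x * Complex.I) ∂uniformLine r) - 1)) := by
  have := isProbabilityMeasure_uniformLine hr
  obtain ⟨n, v, hv, hgv⟩ := exists_enum_of_finite_range hfin
  have hm (k : Fin n) : MeasurableSet (g ⁻¹' {v k}) := hg (measurableSet_singleton _)
  have hW : MeasurableSet (lineWindow r) := measurableSet_Icc.prod measurableSet_Icc
  have hBm (k : Fin n) : MeasurableSet (g ⁻¹' {v k} ∩ lineWindow r) := (hm k).inter hW
  have hdisj : Pairwise fun k l : Fin n =>
      Disjoint (g ⁻¹' {v k} ∩ lineWindow r) (g ⁻¹' {v l} ∩ lineWindow r) := by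
    intro k l hkl
    refine Disjoint.mono Set.inter_subset_left Set.inter_subset_left
      (Disjoint.preimage _ (Set.disjoint_singleton.2 fun e => hkl (hv e)))
  have hind := h.indep_count n (fun k => g ⁻¹' {v k} ∩ lineWindow r) hBm hdisj
  have hU : ∫ x, Complex.exp (g x * Complex.I) ∂uniformLine r =
      ∑ k, (uniformLine r).real (g ⁻¹' {v k}) • Complex.exp (v k * Complex.I) :=
    integral_comp_eq_sum_of_finite_range hg hv hgv (fun t : ℝ => Complex.exp (t * Complex.I))
  -- The `1` is split along the level sets as total mass, so that both terms of the exponent are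
  -- sums over `k`.
  have hone : (1 : ℂ) = ∑ k, (uniformLine r).real (g ⁻¹' {v k}) • (1 : ℂ) := by
    have := integral_comp_eq_sum_of_finite_range (μ := uniformLine r) hg hv hgv
      (fun _ : ℝ => (1 : ℂ))
    simpa using this
  have hrep : ∀ᵐ ω ∂P, Complex.exp ((∫ x, g x ∂(η ω : Measure (ℝ × ℝ)) : ℝ) * Complex.I) =
      ∏ k, Complex.exp (((pointMeasure (fun i => ξ i ω) (g ⁻¹' {v k} ∩ lineWindow r)).toReal *
        v k : ℝ) * Complex.I) := by
    filter_upwards [hη] with ω hω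
    rw [integral_comp_eq_sum_of_finite_range hg hv hgv (fun t => t), Complex.ofReal_sum,
      Finset.sum_mul, Complex.exp_sum]
    refine Finset.prod_congr rfl fun k _ => ?_
    rw [hω, measureReal_def, Measure.restrict_apply (hm k), smul_eq_mul]
  have hprod := hind.integral_fun_prod_comp
    (f := fun k (t : ENNReal) => Complex.exp ((t.toReal * v k : ℝ) * Complex.I))
    (fun k => (h.measurable_count (hBm k)).aemeasurable)
    (fun k => Measurable.aestronglyMeasurable (by fun_prop))
  rw [integral_congr_ae hrep, hprod, hU, hone, ← Finset.sum_sub_distrib, Finset.mul_sum,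
    Complex.exp_sum]
  refine Finset.prod_congr rfl fun k _ => ?_
  have hli := lineIntensity_inter_lineWindow hlam hr (hm k)
  rw [h.integral_exp_count (hBm k), hli]
  · rw [ENNReal.toReal_mul, ENNReal.toReal_ofReal (by positivity),
      Real.coe_toNNReal _ (by positivity), Complex.real_smul, Complex.real_smul,
      Complex.ofReal_mul, measureReal_def]
    ring_nf
  · rw [hli]
    exact ENNReal.mul_ne_top ENNReal.ofReal_ne_top (measure_ne_top _ _)

end IsPoissonLineProcess

/-! ### The normalized sum as a functional of the point measure -/

/-- The normalized sum of a finite counting measure of lines. -/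
noncomputable def pointFunctional (r a b : ℝ) (μ : FiniteMeasure (ℝ × ℝ)) : ℝ :=
  (((∫⁻ q, ENNReal.ofReal (crossKernel r a b q.1 q.2)
        ∂(μ : Measure (ℝ × ℝ)).prod (μ : Measure (ℝ × ℝ))).toReal -
      (∫⁻ x, ENNReal.ofReal (crossKernel r a b x x) ∂(μ : Measure (ℝ × ℝ))).toReal) / 2 -
    (μ : Measure (ℝ × ℝ)).real Set.univ * ((μ : Measure (ℝ × ℝ)).real Set.univ - 1) / 2
      * muB a b) /
    ((μ : Measure (ℝ × ℝ)).real Set.univ * ((μ : Measure (ℝ × ℝ)).real Set.univ - 1)) ^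
      (3 / 4 : ℝ)

theorem measurable_crossKernel_diag (r a b : ℝ) :
    Measurable fun x : ℝ × ℝ => crossKernel r a b x x := by
  have h := (measurable_crossKernel r a b).comp (measurable_id.prodMk measurable_id)
  exact h

theorem measurable_pointFunctional (r a b : ℝ) : Measurable (pointFunctional r a b) := by
  have hprod : Measurable fun μ : FiniteMeasure (ℝ × ℝ) =>
      (μ : Measure (ℝ × ℝ)).prod (μ : Measure (ℝ × ℝ)) :=
    FiniteMeasure.measurable_fun_prod.comp (measurable_id.prodMk measurable_id)
  have h1 := ((Measure.measurable_lintegral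
    (measurable_crossKernel r a b).ennreal_ofReal).comp hprod).ennreal_toReal
  have hcoe : Measurable fun μ : FiniteMeasure (ℝ × ℝ) => (μ : Measure (ℝ × ℝ)) :=
    measurable_subtype_coe
  have h2 := ((Measure.measurable_lintegral
    (measurable_crossKernel_diag r a b).ennreal_ofReal).comp hcoe).ennreal_toReal
  have h3 := measurable_finiteMeasure_real (E := ℝ × ℝ) MeasurableSet.univ
  have h4 := h3.mul (h3.sub_const 1)
  exact (((h1.sub h2).div_const 2).sub ((h4.div_const 2).mul_const _)).div (h4.pow_const _)

theorem diracSum_real_univ {E : Type*} [MeasurableSpace E] (I : Finset ℕ) (x : ℕ → E) :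
    (diracSum I x : Measure E).real Set.univ = I.card := by
  simp [coe_diracSum, measureReal_def]

/-- The product of the counting measure with itself counts all ordered pairs of indices. Removing
the diagonal and halving leaves the pairs `i < j`, by symmetry of the kernel. Hence the numbering of
the lines does not matter. -/
theorem pointFunctional_diracSum (r a b : ℝ) (I : Finset ℕ) (x : ℕ → ℝ × ℝ) :
    pointFunctional r a b (diracSum I x) = normalizedSum r a b I x := by
  have hk := (measurable_crossKernel r a b).ennreal_ofReal
  have h1 : (∫⁻ q, ENNReal.ofReal (crossKernel r a b q.1 q.2)
      ∂(diracSum I x : Measure (ℝ × ℝ)).prod (diracSum I x : Measure (ℝ × ℝ))).toReal =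
      ∑ i ∈ I, ∑ j ∈ I, crossKernel r a b (x i) (x j) := by
    rw [lintegral_prod _ hk.aemeasurable, lintegral_diracSum _ _ hk.lintegral_prod_right']
    simp only [lintegral_diracSum _ _ (measurable_crossKernel_right r a b _).ennreal_ofReal]
    rw [ENNReal.toReal_sum fun i _ => ENNReal.sum_ne_top.2 fun j _ => ENNReal.ofReal_ne_top]
    refine Finset.sum_congr rfl fun i _ => ?_
    rw [ENNReal.toReal_sum fun j _ => ENNReal.ofReal_ne_top]
    exact Finset.sum_congr rfl fun j _ =>
      ENNReal.toReal_ofReal (crossKernel_mem_Icc r a b _ _).1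
  have h2 : (∫⁻ y, ENNReal.ofReal (crossKernel r a b y y)
      ∂(diracSum I x : Measure (ℝ × ℝ))).toReal = ∑ i ∈ I, crossKernel r a b (x i) (x i) := by
    rw [lintegral_diracSum _ _ (measurable_crossKernel_diag r a b).ennreal_ofReal,
      ENNReal.toReal_sum fun j _ => ENNReal.ofReal_ne_top]
    exact Finset.sum_congr rfl fun j _ =>
      ENNReal.toReal_ofReal (crossKernel_mem_Icc r a b _ _).1
  have h3 := sum_sum_eq_sum_diag_add_sum_orderedPairs I
    (fun i j => crossKernel r a b (x i) (x j))
  have h4 : ∑ p ∈ orderedPairs I, (crossKernel r a b (x p.1) (x p.2) +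
      crossKernel r a b (x p.2) (x p.1)) =
      2 * ∑ p ∈ orderedPairs I, crossKernel r a b (x p.1) (x p.2) := by
    rw [Finset.mul_sum]
    exact Finset.sum_congr rfl fun p _ => by rw [crossKernel_comm r a b (x p.2)]; ring
  unfold pointFunctional normalizedSum
  rw [h1, h2, h3, h4, diracSum_real_univ, Finset.sum_sub_distrib, Finset.sum_const,
    nsmul_eq_mul, card_orderedPairs]
  congr 1
  ring

/-! ### Poisson line processes -/

theorem measurableSet_lineWindow (r : ℝ) : MeasurableSet (lineWindow r) :=
  measurableSet_Icc.prod measurableSet_Icc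

theorem pointMeasure_apply (x : ℕ → ℝ × ℝ) {B : Set (ℝ × ℝ)} (hB : MeasurableSet B) :
    pointMeasure x B = ∑' i, B.indicator 1 (x i) := by
  simp only [pointMeasure, Measure.sum_apply _ hB, Measure.dirac_apply' _ hB]

theorem pointMeasure_ne_top_iff (x : ℕ → ℝ × ℝ) {B : Set (ℝ × ℝ)} (hB : MeasurableSet B) :
    pointMeasure x B ≠ ⊤ ↔ {i | x i ∈ B}.Finite := by
  have h : pointMeasure x B = ({i | x i ∈ B}.encard : ENNReal) := by
    rw [pointMeasure_apply x hB, ← ENNReal.tsum_set_one,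
      tsum_subtype {i | x i ∈ B} fun _ => (1 : ENNReal)]
    rfl
  rw [h, Ne, ENat.toENNReal_eq_top, Set.encard_eq_top_iff, Set.not_infinite]

theorem diracSum_windowIndices_apply (r : ℝ) (x : ℕ → ℝ × ℝ) {B : Set (ℝ × ℝ)}
    (hB : MeasurableSet B) (hx : pointMeasure x (lineWindow r) ≠ ⊤) :
    (diracSum (windowIndices r x) x : Measure (ℝ × ℝ)) B = pointMeasure x (B ∩ lineWindow r) := by
  have hfin := (pointMeasure_ne_top_iff x (measurableSet_lineWindow r)).1 hx
  have hmem (i : ℕ) : i ∈ windowIndices r x ↔ x i ∈ lineWindow r := by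
    rw [windowIndices, dif_pos hfin, Set.Finite.mem_toFinset]
    rfl
  rw [pointMeasure_apply x (hB.inter (measurableSet_lineWindow r)), coe_diracSum,
    Measure.finsetSum_apply, tsum_eq_sum (s := windowIndices r x)]
  · refine Finset.sum_congr rfl fun i hi => ?_
    have hi' := (hmem i).1 hi
    rw [Measure.dirac_apply' _ hB]
    by_cases hxB : x i ∈ B
    · have h2 : x i ∈ B ∩ lineWindow r := ⟨hxB, hi'⟩
      rw [Set.indicator_of_mem hxB, Set.indicator_of_mem h2]
    · have h2 : x i ∉ B ∩ lineWindow r := fun h => hxB h.1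
      rw [Set.indicator_of_notMem hxB, Set.indicator_of_notMem h2]
  · intro i hi
    exact Set.indicator_of_notMem (fun h => hi ((hmem i).2 h.2)) _

theorem windowIndices_eq_empty (r : ℝ) (x : ℕ → ℝ × ℝ)
    (hx : pointMeasure x (lineWindow r) = ⊤) : windowIndices r x = ∅ := by
  rw [windowIndices, dif_neg]
  exact fun h => (pointMeasure_ne_top_iff x (measurableSet_lineWindow r)).2 h hx

namespace IsPoissonLineProcess

variable {Ω : Type*} [MeasurableSpace Ω] {P : Measure Ω} {lam : ℝ} {ξ : ℕ → Ω → ℝ × ℝ}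

theorem ae_pointMeasure_ne_top (h : IsPoissonLineProcess P lam ξ)
    {B : Set (ℝ × ℝ)} (hB : MeasurableSet B) (hfin : lineIntensity lam B ≠ ⊤) :
    ∀ᵐ ω ∂P, pointMeasure (fun i => ξ i ω) B ≠ ⊤ := by
  have hs : MeasurableSet {t : ENNReal | t ≠ ⊤} := (measurableSet_singleton _).compl
  rw [(h.law_count B hB hfin).ae_iff (p := fun t => t ≠ ⊤) (measurableSet_setOfPred.1 hs),
    ae_map_iff .of_discrete hs]
  exact ae_of_all _ fun n => ENNReal.natCast_ne_top n

/-- The random index set is avoided: the mass of `B` is the count in `B ∩ lineWindow r`, or `0` on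
the event of infinitely many points in the window. -/
theorem measurable_diracSum_windowIndices (h : IsPoissonLineProcess P lam ξ) (r : ℝ) :
    Measurable fun ω => diracSum (windowIndices r fun i => ξ i ω) fun i => ξ i ω := by
  classical
  have hW := measurableSet_lineWindow r
  refine Measurable.subtype_mk (Measure.measurable_of_measurable_coe _ fun B hB => ?_)
  have hrep : (fun ω => (∑ i ∈ windowIndices r fun i => ξ i ω, Measure.dirac (ξ i ω)) B) =
      fun ω => if pointMeasure (fun i => ξ i ω) (lineWindow r) = ⊤ then 0
        else pointMeasure (fun i => ξ i ω) (B ∩ lineWindow r) := by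
    ext ω
    split_ifs with hω
    · rw [windowIndices_eq_empty r _ hω]
      simp
    · exact diracSum_windowIndices_apply r _ hB hω
  rw [hrep]
  exact Measurable.ite (h.measurable_count hW (measurableSet_singleton _)) measurable_const
    (h.measurable_count (hB.inter hW))

/-- Both random measures have the characteristic functional `exp (2 λ r (E exp (i g) - 1))`, with
`E` the mean over a uniform line. -/
theorem map_diracSum_windowIndices [IsProbabilityMeasure P] (h : IsPoissonLineProcess P lam ξ)
    (hlam : 0 < lam) {r : ℝ} (hr : 0 < r) :
    P.map (fun ω => diracSum (windowIndices r fun i => ξ i ω) fun i => ξ i ω) =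
      (mixedSample lam r).map (fun w => diracSum (Finset.range w.1) w.2) := by
  have := isProbabilityMeasure_mixedSample lam hr
  have := isProbabilityMeasure_uniformLine hr
  have hW := measurableSet_lineWindow r
  have hfinW : lineIntensity lam (lineWindow r) ≠ ⊤ := by
    have := lineIntensity_inter_lineWindow hlam hr MeasurableSet.univ
    rw [Set.univ_inter] at this
    rw [this]
    exact ENNReal.mul_ne_top ENNReal.ofReal_ne_top (measure_ne_top _ _)
  refine map_finiteMeasure_eq_of_charFunctional (h.measurable_diracSum_windowIndices r)
    (measurable_from_prod_countable_right fun n => measurable_diracSum (Finset.range n))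
    fun g hg hfin => ?_
  rw [h.integral_exp_pointMeasure hlam hr ?_ hg hfin, mixedSample,
    integral_exp_diracSum_mixed _ _ hg]
  filter_upwards [h.ae_pointMeasure_ne_top hW hfinW] with ω hω
  ext B hB
  rw [diracSum_windowIndices_apply r _ hB hω, Measure.restrict_apply hB]

end IsPoissonLineProcess

theorem theorem5p1 {Ω : Type*} [MeasurableSpace Ω] (P : Measure Ω) [IsProbabilityMeasure P]
    (lam : ℝ) (hlam : 0 < lam) (a b : ℝ) (ha : 0 ≤ a) (hab : a < b) (hb : b ≤ Real.pi) :
    -- the moments of the kernel do not depend on the radius, and their explicit values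
    (∀ r : ℝ, 0 < r → kernelMean r a b = muB a b ∧ kernelSecondMoment r a b = sigmaB a b) ∧
    muB a b = 1 / (2 * Real.pi) * (a - Real.sin b + Real.sin (b - a)) ∧
    sigmaB a b = 2 / (3 * Real.pi ^ 3) *
      (4 * a + b + Real.sin b * Real.cos b - 7 / 2 * (Real.sin a + Real.sin b)
        + 4 * Real.sin (b - a) + a * Real.cos b - (b - a) * Real.cos a
        + 1 / 2 * (Real.sin (2 * a - b) - Real.sin (2 * b - a))) ∧
    muB a b ^ 2 ≤ sigmaB a b ∧
    -- the limit theorem for `N_r` and the independent uniform `X_1, X_2, …`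
    (∀ (N : ℝ → Ω → ℕ) (X : ℝ → ℕ → Ω → ℝ × ℝ),
      (∀ r : ℝ, 0 < r → IsPoissonLineSample P lam r (N r) (X r)) →
      TendstoInDistribution
        (fun (r : Set.Ioi (0 : ℝ)) (ω : Ω) =>
          normalizedSum r a b (Finset.range (N r ω)) (fun i => X r i ω))
        atTop (id : ℝ → ℝ) (fun _ => P)
        (gaussianReal 0 (sigmaB a b - muB a b ^ 2).toNNReal)) ∧
    -- the limit theorem for the lines of a Poisson line process that hit the disc of radius `r`
    (∀ ξ : ℕ → Ω → ℝ × ℝ, IsPoissonLineProcess P lam ξ →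
      TendstoInDistribution
        (fun (r : Set.Ioi (0 : ℝ)) (ω : Ω) =>
          normalizedSum r a b (windowIndices r (fun i => ξ i ω)) (fun i => ξ i ω))
        atTop (id : ℝ → ℝ) (fun _ => P)
        (gaussianReal 0 (sigmaB a b - muB a b ^ 2).toNNReal)) := by
  refine ⟨fun r hr => ⟨kernelMean_eq_muB hr a b, kernelSecondMoment_eq_sigmaB hr a b⟩,
    muB_eq ha hab hb, sigmaB_eq ha hab hb, muB_sq_le_sigmaB a b, fun N X h => ?_, fun ξ h => ?_⟩
  · have hm (r : Set.Ioi (0 : ℝ)) : Measurable fun ω => (N r ω, fun i => X r i ω) :=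
      (h r r.2).measurable_N.prodMk (measurable_pi_lambda _ (h r r.2).measurable_X)
    refine tendstoInDistribution_of_map_eq_sampleSum hlam
      (fun r => ((measurable_sampleSum r a b).comp (hm r)).aemeasurable) fun r => ?_
    rw [← (h r r.2).map_eq_mixedSample r.2, Measure.map_map (measurable_sampleSum r a b) (hm r)]
    rfl
  -- Both normalized sums are the same functional of a counting measure, so equality of the laws of
  -- the counting measures suffices.
  · have hZ (r : ℝ) : (fun ω => normalizedSum r a b (windowIndices r fun i => ξ i ω)
        fun i => ξ i ω) = pointFunctional r a b ∘
          fun ω => diracSum (windowIndices r fun i => ξ i ω) fun i => ξ i ω := by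
      ext ω
      exact (pointFunctional_diracSum r a b _ _).symm
    have hS (r : ℝ) : sampleSum r a b =
        pointFunctional r a b ∘ fun w => diracSum (Finset.range w.1) w.2 := by
      ext w
      exact (pointFunctional_diracSum r a b _ _).symm
    refine tendstoInDistribution_of_map_eq_sampleSum hlam (fun r => ?_) fun r => ?_
    · rw [hZ]
      exact ((measurable_pointFunctional r a b).comp
        (h.measurable_diracSum_windowIndices r)).aemeasurable
    · rw [hZ, hS, ← Measure.map_map (measurable_pointFunctional r a b)
        (h.measurable_diracSum_windowIndices r), h.map_diracSum_windowIndices hlam r.2,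
        Measure.map_map (measurable_pointFunctional r a b)
          (measurable_from_prod_countable_right fun n => measurable_diracSum (Finset.range n))]
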